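/- Let $N\ge 3$, $R>0$, $2^*-1:=\frac{N+2}{N-2}$, and let $p_{JL}:=1+\frac{4}{N-4-2\sqrt{N-1}}$ if $N\ge 11$ and $p_{JL}:=\infty$ if $3\le N\le 10$. Let $p>2^*-1$, $\theta:=\frac{2}{p-1}$, $A_{p,N}:=[\theta(N-2-\theta)]^{1/(p-1)}$, and let $U=U_p^*$ be a singular solution, i.e. a positive $C^2$ function on $(0,\infty)$ with $$-U''-\frac{N-1}{r}U'+U=U^p\ \text{ on }(0,\infty),\qquad \lim_{r\to0^+}r^\theta U(r)=A_{p,N}.$$ Suppose that $U'(R)=0$, so that $x\mapsto U(|x|)$ satisfies the Neumann boundary condition on $\partial B_R$, where $B_R\subset\mathbb{R}^N$ is the open ball of radius $R$ centred at the origin. (If $(R_p^i)_{i}$ is the increasing sequence of critical points of $U_p^*$, this says that $R=R_p^i$, that is $p=p^i$, for some $i$.) Let $H^1_{rad}(B_R)$ be the space of radially symmetric functions in $H^1(B_R)$, and let the radial Morse index $m(U)\in\{0,1,2,\dots\}\cup\{\infty\}$ be the supremum of the dimensions of the finite-dimensional subspaces of $H^1_{rad}(B_R)$ on which the quadratic form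 $$\mathcal J(\phi)=\int_{B_R}\left(|\nabla\phi|^2+\phi^2-p\,U(|x|)^{p-1}\phi^2\right)dx$$ is negative definite. **Proposition 1.6.** 1. If $p>p_{JL}$, then $m(U)<\infty$. Moreover, the problem $-\Delta\phi+\phi-pU^{p-1}\phi=\alpha\phi$ in $B_R$, $\partial_\nu\phi=0$ on $\partial B_R$, has, in the weak sense in $H^1_{rad}(B_R)$, only finitely many negative eigenvalues $\alpha$, counted with multiplicity. 2. If $2^*-1<p<p_{JL}$, then $m(U)=\infty$. -/

import Mathlib

open MeasureTheory Filter Topology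
open scoped ContDiff

noncomputable section

namespace LinNiTakagi

/-- The critical exponent `2* - 1 = (N + 2) / (N - 2)`. -/
def pCrit (N : ℕ) : ℝ := ((N : ℝ) + 2) / ((N : ℝ) - 2)

/-- The Joseph-Lundgren exponent, equal to `∞` in dimensions at most `10`. -/
def pJL (N : ℕ) : EReal :=
  if 11 ≤ N then ((1 + 4 / ((N : ℝ) - 4 - 2 * Real.sqrt ((N : ℝ) - 1)) : ℝ) : EReal) else ⊤

/-- `θ = 2 / (p - 1)`. -/
def theta (p : ℝ) : ℝ := 2 / (p - 1)

/-- `A_{p,N} = [θ (N - 2 - θ)]^{1/(p-1)}`. -/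
def singAmplitude (N : ℕ) (p : ℝ) : ℝ :=
  (theta p * ((N : ℝ) - 2 - theta p)) ^ (1 / (p - 1))

/-- `U` is a (classical, positive) radial solution on `(0, ∞)` of
`-U'' - (N - 1) / r U' + U = U ^ p` with `r ^ θ U(r) → A_{p,N}` as `r → 0+`.
The values of `U` on `(-∞, 0]` play no role. -/
structure IsSingularSolution (N : ℕ) (p : ℝ) (U : ℝ → ℝ) : Prop where
  contDiffOn : ContDiffOn ℝ 2 U (Set.Ioi 0)
  ode : ∀ r : ℝ, 0 < r →
    -(deriv (deriv U) r) - ((N : ℝ) - 1) / r * deriv U r + U r = U r ^ p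
  tendsto_zero : Tendsto (fun r : ℝ => r ^ theta p * U r) (𝓝[>] 0) (𝓝 (singAmplitude N p))
  pos : ∀ r : ℝ, 0 < r → 0 < U r

/-- Lebesgue measure on the ball `B_R` of `ℝ^N`. -/
abbrev ballMeasure (N : ℕ) (R : ℝ) : Measure (EuclideanSpace ℝ (Fin N)) :=
  volume.restrict (Metric.ball 0 R)

/-- Pairs `(u, G)` with `u ∈ L²(B_R)` and `G ∈ L²(B_R; ℝ^N)`. -/
abbrev L2Pair (N : ℕ) (R : ℝ) : Type :=
  Lp ℝ 2 (ballMeasure N R) × Lp (EuclideanSpace ℝ (Fin N)) 2 (ballMeasure N R)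

/-- `G` is the weak (distributional) gradient of `u` on `B_R`. -/
def IsWeakGradient {N : ℕ} {R : ℝ} (u : Lp ℝ 2 (ballMeasure N R))
    (G : Lp (EuclideanSpace ℝ (Fin N)) 2 (ballMeasure N R)) : Prop :=
  ∀ φ : EuclideanSpace ℝ (Fin N) → ℝ, ContDiff ℝ ∞ φ → HasCompactSupport φ →
    tsupport φ ⊆ Metric.ball 0 R → ∀ v : EuclideanSpace ℝ (Fin N),
      ∫ x, u x * fderiv ℝ φ x v ∂(ballMeasure N R) =
        -∫ x, inner ℝ (G x) v * φ x ∂(ballMeasure N R)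

/-- `u` is radially symmetric: it agrees almost everywhere with a function of `|x|`. -/
def IsRadial {N : ℕ} {R : ℝ} (u : Lp ℝ 2 (ballMeasure N R)) : Prop :=
  ∃ f : ℝ → ℝ, Measurable f ∧ ∀ᵐ x ∂(ballMeasure N R), u x = f ‖x‖

lemma integrable_left {N : ℕ} {R : ℝ} (u : Lp ℝ 2 (ballMeasure N R))
    {φ : EuclideanSpace ℝ (Fin N) → ℝ} (h1 : ContDiff ℝ ∞ φ) (h2 : HasCompactSupport φ)
    (v : EuclideanSpace ℝ (Fin N)) :
    Integrable (fun x => u x * fderiv ℝ φ x v) (ballMeasure N R) := by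
  have hc : Continuous fun x => fderiv ℝ φ x v :=
    (h1.continuous_fderiv (by simp)).clm_apply continuous_const
  have hs : HasCompactSupport fun x => fderiv ℝ φ x v := by
    have := h2.fderiv (𝕜 := ℝ)
    exact this.comp_left (g := fun L : EuclideanSpace ℝ (Fin N) →L[ℝ] ℝ => L v) (by simp)
  exact (Lp.memLp u).integrable_mul (hc.memLp_of_hasCompactSupport (p := 2) hs)

lemma integrable_right {N : ℕ} {R : ℝ}
    (G : Lp (EuclideanSpace ℝ (Fin N)) 2 (ballMeasure N R))
    {φ : EuclideanSpace ℝ (Fin N) → ℝ} (h1 : ContDiff ℝ ∞ φ) (h2 : HasCompactSupport φ)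
    (v : EuclideanSpace ℝ (Fin N)) :
    Integrable (fun x => inner ℝ (G x) v * φ x) (ballMeasure N R) := by
  have hG : MemLp (fun x => inner ℝ (G x) v) 2 (ballMeasure N R) := (Lp.memLp G).inner_const v
  exact hG.integrable_mul (h1.continuous.memLp_of_hasCompactSupport (p := 2) h2)

/-- The space `H¹_rad(B_R)` of radially symmetric functions in `H¹(B_R)`, realised as the space
of pairs `(u, ∇u)`, where `∇u` is the (unique) weak gradient of `u`. -/
def H1rad (N : ℕ) (R : ℝ) : Submodule ℝ (L2Pair N R) where
  carrier := {w | IsRadial w.1 ∧ IsWeakGradient w.1 w.2}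
  zero_mem' := by
    refine ⟨⟨fun _ => 0, measurable_const, ?_⟩, ?_⟩
    · filter_upwards [Lp.coeFn_zero ℝ 2 (ballMeasure N R)] with x hx
      simpa using hx
    · intro φ _ _ _ v
      have e1 : ∫ x, (0 : L2Pair N R).1 x * fderiv ℝ φ x v ∂(ballMeasure N R) = 0 := by
        apply integral_eq_zero_of_ae
        filter_upwards [Lp.coeFn_zero ℝ 2 (ballMeasure N R)] with x hx
        simp only [Prod.fst_zero, hx, Pi.zero_apply, zero_mul]
      have e2 : ∫ x, inner ℝ ((0 : L2Pair N R).2 x) v * φ x ∂(ballMeasure N R) = 0 := by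
        apply integral_eq_zero_of_ae
        filter_upwards [Lp.coeFn_zero (EuclideanSpace ℝ (Fin N)) 2 (ballMeasure N R)] with x hx
        simp only [Prod.snd_zero, hx, Pi.zero_apply, zero_mul, inner_zero_left]
      rw [e1, e2, neg_zero]
  add_mem' := by
    rintro ⟨u, G⟩ ⟨u', G'⟩ ⟨⟨f, hf, hu⟩, hG⟩ ⟨⟨f', hf', hu'⟩, hG'⟩
    refine ⟨⟨fun r => f r + f' r, hf.add hf', ?_⟩, ?_⟩
    · filter_upwards [hu, hu', Lp.coeFn_add u u'] with x h1 h2 h3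
      simpa [h1, h2] using h3
    · intro φ h1 h2 h3 v
      have e1 : ∫ x, (u + u') x * fderiv ℝ φ x v ∂(ballMeasure N R) =
          ∫ x, u x * fderiv ℝ φ x v ∂(ballMeasure N R) +
            ∫ x, u' x * fderiv ℝ φ x v ∂(ballMeasure N R) := by
        rw [← integral_add (integrable_left u h1 h2 v) (integrable_left u' h1 h2 v)]
        apply integral_congr_ae
        filter_upwards [Lp.coeFn_add u u'] with x hx
        simp only [hx, Pi.add_apply, add_mul]
      have e2 : ∫ x, inner ℝ ((G + G') x) v * φ x ∂(ballMeasure N R) =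
          ∫ x, inner ℝ (G x) v * φ x ∂(ballMeasure N R) +
            ∫ x, inner ℝ (G' x) v * φ x ∂(ballMeasure N R) := by
        rw [← integral_add (integrable_right G h1 h2 v) (integrable_right G' h1 h2 v)]
        apply integral_congr_ae
        filter_upwards [Lp.coeFn_add G G'] with x hx
        simp only [hx, Pi.add_apply, inner_add_left, add_mul]
      have a1 := hG φ h1 h2 h3 v
      have a2 := hG' φ h1 h2 h3 v
      simp only [Prod.mk_add_mk] at a1 a2 ⊢
      rw [e1, e2, a1, a2]
      ring
  smul_mem' := by
    rintro c ⟨u, G⟩ ⟨⟨f, hf, hu⟩, hG⟩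
    refine ⟨⟨fun r => c * f r, hf.const_mul c, ?_⟩, ?_⟩
    · filter_upwards [hu, Lp.coeFn_smul c u] with x h1 h3
      simpa [h1] using h3
    · intro φ h1 h2 h3 v
      have e1 : ∫ x, (c • u) x * fderiv ℝ φ x v ∂(ballMeasure N R) =
          c * ∫ x, u x * fderiv ℝ φ x v ∂(ballMeasure N R) := by
        rw [← integral_const_mul]
        apply integral_congr_ae
        filter_upwards [Lp.coeFn_smul c u] with x hx
        simp [hx, mul_assoc]
      have e2 : ∫ x, inner ℝ ((c • G) x) v * φ x ∂(ballMeasure N R) =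
          c * ∫ x, inner ℝ (G x) v * φ x ∂(ballMeasure N R) := by
        rw [← integral_const_mul]
        apply integral_congr_ae
        filter_upwards [Lp.coeFn_smul c G] with x hx
        simp [hx, inner_smul_left, mul_assoc]
      have a1 := hG φ h1 h2 h3 v
      simp only [Prod.smul_mk] at a1 ⊢
      rw [e1, e2, a1]
      ring

/-- The bilinear form of the operator `-Δ + 1 - p U(|x|)^{p-1}` on `B_R` with Neumann boundary
condition, `∫ ∇u·∇v + u v - p U^{p-1} u v`, at `w = (u, ∇u)` and `z = (v, ∇v)`. -/
def linForm {N : ℕ} {R : ℝ} (p : ℝ) (U : ℝ → ℝ) (w z : L2Pair N R) : ℝ :=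
  ∫ x, (inner ℝ (w.2 x) (z.2 x) + w.1 x * z.1 x - p * U ‖x‖ ^ (p - 1) * (w.1 x * z.1 x))
    ∂(ballMeasure N R)

/-- The radial Morse index of `U` on `B_R`: the supremum of the dimensions of the
finite-dimensional subspaces of `H¹_rad(B_R)` on which the quadratic form
`∫ |∇u|² + u² - p U^{p-1} u²` is negative definite. -/
def radialMorseIndex (N : ℕ) (R p : ℝ) (U : ℝ → ℝ) : ℕ∞ :=
  ⨆ V ∈ {V : Submodule ℝ (L2Pair N R) | V ≤ H1rad N R ∧ FiniteDimensional ℝ V ∧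
      ∀ w ∈ V, w ≠ 0 → linForm p U w w < 0}, (Module.finrank ℝ V : ℕ∞)

/-- `w = (φ, ∇φ)` is a weak solution in `H¹_rad(B_R)` of
`-Δφ + φ - p U^{p-1} φ = α φ` with Neumann boundary condition `∂_ν φ = 0` on `∂B_R`. -/
def IsRadialEigenfunction {N : ℕ} {R : ℝ} (p : ℝ) (U : ℝ → ℝ) (α : ℝ) (w : L2Pair N R) : Prop :=
  w ∈ H1rad N R ∧
    ∀ z ∈ H1rad N R, linForm p U w z = α * ∫ x, w.1 x * z.1 x ∂(ballMeasure N R)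

/-- The sum of all eigenspaces that belong to negative eigenvalues; its dimension is the number
of negative eigenvalues counted with multiplicity. -/
def negativeEigenspace (N : ℕ) (R p : ℝ) (U : ℝ → ℝ) : Submodule ℝ (L2Pair N R) :=
  Submodule.span ℝ {w | ∃ α : ℝ, α < 0 ∧ IsRadialEigenfunction p U α w}

end LinNiTakagi

end

/-!
Write `V = p U^{p-1}`. The asymptotics of `U` give `r² V(r) → p θ (N - 2 - θ)` as `r → 0`, and the
exponents `p_JL` and `2* - 1` are such that this limit lies below Hardy's constant `((N - 2) / 2)²`
for `p > p_JL` and above it for `2* - 1 < p < p_JL` (`hardyStrength_lt_of_pJL_lt`,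
`lt_hardyStrength_of_lt_pJL`). Hence the sign of the form near the origin is decided by Hardy's
inequality, while away from the origin `V` is bounded.

Below Hardy's constant, a pair `(u, ∇u)` in `H¹_rad(B_R)` is described by an absolutely
continuous profile `f` with `u(x) = f(|x|)` and derivative `g`, the conditional expectation of the
radial part of `∇u` given `|x|` (`exists_isRadialProfile`). If `u` has mean zero on each of
sufficiently many concentric shells between a small radius `a` and `R`, then `f` has a zero in each
shell, and the form is nonnegative at `u`: on `(0, a)` Hardy's inequality for a profile vanishing
somewhere in the first shell uses up a fraction `< 1` of the kinetic energy, and the remaining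
fraction suffices for Poincaré's inequality on the thin shells
(`IsHardyPotential.integral_le_of_zeros`). So the form is nonnegative on the kernel of a linear map
into some `ℝ^k` (`exists_linearMap_nonneg_on_ker`). That map is injective on every subspace on which
the form is negative definite, and also on the span of the eigenfunctions with negative eigenvalues,
because eigenspaces are orthogonal. No compact embedding is needed.

Above Hardy's constant, the functions `r^{-(N-2)/2} β(m log r + d)` with a bump `β` and small `m`
have negative energy when supported near `0`: in the variable `s = m log r + d` the energy is at
most a positive multiple of `m ∫ β'² + m⁻¹ ((N-2)²/4 - c) ∫ β²` with `c > (N-2)²/4`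
(`integral_logBump`). Infinitely many values of `d` give disjoint supports, hence a form-orthogonal
family of negative directions.
-/

open MeasureTheory Filter Topology
open scoped ContDiff

noncomputable section

namespace LinNiTakagi

/-! ### Radial integrals and radial test functions -/

/-- The surface area of the unit sphere of `ℝ^N`, the factor in front of polar integrals. -/
def sphereArea (N : ℕ) : ℝ :=
  (N : ℝ) * volume.real (Metric.ball (0 : EuclideanSpace ℝ (Fin N)) 1)

lemma sphereArea_pos {N : ℕ} (hN : 1 ≤ N) : 0 < sphereArea N := by
  have : 0 < volume.real (Metric.ball (0 : EuclideanSpace ℝ (Fin N)) 1) :=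
    ENNReal.toReal_pos (Metric.measure_ball_pos _ _ one_pos).ne' measure_ball_lt_top.ne
  unfold sphereArea
  positivity

lemma integral_ball_radial {N : ℕ} (hN : 1 ≤ N) (R : ℝ) (F : ℝ → ℝ) :
    ∫ x, F ‖x‖ ∂(ballMeasure N R) =
      sphereArea N * ∫ r in Set.Ioo 0 R, r ^ (N - 1) * F r := by
  have : Nonempty (Fin N) := ⟨⟨0, hN⟩⟩
  have h1 : ∫ x, F ‖x‖ ∂(ballMeasure N R) =
      ∫ x : EuclideanSpace ℝ (Fin N), (Set.Iio R).indicator F ‖x‖ := by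
    rw [← integral_indicator Metric.isOpen_ball.measurableSet]
    congr 1 with x
    simp [Set.indicator]
  rw [h1, integral_fun_norm_addHaar]
  have h2 : ∫ y in Set.Ioi (0 : ℝ), y ^ (N - 1) • (Set.Iio R).indicator F y =
      ∫ r in Set.Ioo 0 R, r ^ (N - 1) * F r := by
    rw [← integral_indicator measurableSet_Ioi, ← integral_indicator measurableSet_Ioo]
    congr 1 with y
    by_cases h0 : 0 < y <;> by_cases h3 : y < R <;> simp [h0, h3]
  simp only [finrank_euclideanSpace, Fintype.card_fin] at h2 ⊢
  rw [h2, sphereArea]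
  simp [mul_assoc]

lemma integrable_ball_radial {N : ℕ} (hN : 1 ≤ N) (R : ℝ) (F : ℝ → ℝ) :
    Integrable (fun x => F ‖x‖) (ballMeasure N R) ↔
      IntegrableOn (fun r => r ^ (N - 1) * F r) (Set.Ioo 0 R) := by
  have : Nonempty (Fin N) := ⟨⟨0, hN⟩⟩
  have := integrableOn_fun_norm_addHaar (E := EuclideanSpace ℝ (Fin N)) volume (f := F) (r := R)
  simpa [IntegrableOn] using this

instance isFiniteMeasure_ballMeasure (N : ℕ) (R : ℝ) : IsFiniteMeasure (ballMeasure N R) :=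
  ⟨by simpa using measure_ball_lt_top⟩

lemma ae_ball_of_ae_Ioo {N : ℕ} (hN : 1 ≤ N) {R : ℝ} {P : ℝ → Prop}
    (h : ∀ᵐ r : ℝ, r ∈ Set.Ioo 0 R → P r) : ∀ᵐ x ∂(ballMeasure N R), P ‖x‖ := by
  set S : Set ℝ := {r | ¬ (r ∈ Set.Ioo 0 R → P r)} ∪ {0} with hS
  have hS0 : volume S = 0 := by
    rw [hS, measure_union_null_iff]
    exact ⟨h, by simp⟩
  set A := toMeasurable volume S with hA
  have hA0 : volume A = 0 := by rw [hA, measure_toMeasurable, hS0]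
  have hAm : MeasurableSet A := measurableSet_toMeasurable _ _
  have h1 : ∫ x, A.indicator (fun _ => (1 : ℝ)) ‖x‖ ∂(ballMeasure N R) = 0 := by
    rw [integral_ball_radial hN]
    have : ∫ r in Set.Ioo 0 R, r ^ (N - 1) * A.indicator (fun _ => (1 : ℝ)) r = 0 := by
      apply integral_eq_zero_of_ae
      apply ae_restrict_of_ae
      filter_upwards [measure_eq_zero_iff_ae_notMem.1 hA0] with r hr
      simp [hr]
    rw [this, mul_zero]
  have h2 : ∫ x, A.indicator (fun _ => (1 : ℝ)) ‖x‖ ∂(ballMeasure N R) =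
      (ballMeasure N R).real (norm ⁻¹' A) := by
    rw [← integral_indicator_one (measurable_norm hAm)]
    rfl
  have h3 : ballMeasure N R (norm ⁻¹' A) = 0 := by
    rw [h2] at h1
    exact (measureReal_eq_zero_iff (measure_ne_top _ _)).1 h1
  have h4 : ∀ᵐ x ∂(ballMeasure N R), x ∈ Metric.ball (0 : EuclideanSpace ℝ (Fin N)) R :=
    ae_restrict_mem Metric.isOpen_ball.measurableSet
  filter_upwards [h4, measure_eq_zero_iff_ae_notMem.1 h3] with x hx hxA
  have hxS : ‖x‖ ∉ S := fun h' => hxA (subset_toMeasurable _ _ h')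
  simp only [hS, Set.mem_union, Set.mem_ofPred_eq, Set.mem_singleton_iff, not_or, not_not] at hxS
  exact hxS.1 ⟨lt_of_le_of_ne (norm_nonneg _) (Ne.symm hxS.2), by simpa using hx⟩

/-- `ζ` is smooth on `(0, ∞)` and, on `[0, ∞)`, vanishes outside `[a, b]`; the values at negative
radii are irrelevant for `x ↦ ζ ‖x‖`. -/
structure IsAnnularProfile (ζ : ℝ → ℝ) (a b : ℝ) : Prop where
  contDiffOn : ContDiffOn ℝ ∞ ζ (Set.Ioi 0)
  eq_zero : ∀ r, 0 ≤ r → r ∉ Set.Icc a b → ζ r = 0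
  pos : 0 < a

namespace IsAnnularProfile

variable {ζ : ℝ → ℝ} {a b : ℝ} {N : ℕ}

lemma contDiffAt (h : IsAnnularProfile ζ a b) {r : ℝ} (hr : 0 < r) : ContDiffAt ℝ ∞ ζ r :=
  h.contDiffOn.contDiffAt (Ioi_mem_nhds hr)

lemma eventually_eq_zero (h : IsAnnularProfile ζ a b) :
    (fun x : EuclideanSpace ℝ (Fin N) => ζ ‖x‖) =ᶠ[𝓝 0] fun _ => 0 := by
  filter_upwards [Metric.ball_mem_nhds (0 : EuclideanSpace ℝ (Fin N)) h.pos] with x hx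
  apply h.eq_zero _ (norm_nonneg _)
  intro hx'
  simp only [Metric.mem_ball, dist_zero_right] at hx
  linarith [hx'.1]

lemma contDiff_norm (h : IsAnnularProfile ζ a b) :
    ContDiff ℝ ∞ (fun x : EuclideanSpace ℝ (Fin N) => ζ ‖x‖) := by
  rw [contDiff_iff_contDiffAt]
  intro x
  by_cases hx : x = 0
  · subst hx
    exact contDiffAt_const.congr_of_eventuallyEq h.eventually_eq_zero
  · exact (h.contDiffAt (norm_pos_iff.2 hx)).comp x (contDiffAt_norm ℝ hx)

lemma tsupport_norm_subset (h : IsAnnularProfile ζ a b) :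
    tsupport (fun x : EuclideanSpace ℝ (Fin N) => ζ ‖x‖) ⊆ Metric.closedBall 0 b := by
  apply closure_minimal _ Metric.isClosed_closedBall
  intro x hx
  by_contra hx'
  simp only [Metric.mem_closedBall, dist_zero_right, not_le] at hx'
  exact hx (h.eq_zero _ (norm_nonneg _) fun h2 => by linarith [h2.2])

lemma hasCompactSupport_norm (h : IsAnnularProfile ζ a b) :
    HasCompactSupport (fun x : EuclideanSpace ℝ (Fin N) => ζ ‖x‖) :=
  (isCompact_closedBall (0 : EuclideanSpace ℝ (Fin N)) b).of_isClosed_subset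
    (isClosed_tsupport _) h.tsupport_norm_subset

lemma hasFDerivAt_norm (h : IsAnnularProfile ζ a b) (x : EuclideanSpace ℝ (Fin N)) :
    HasFDerivAt (fun x : EuclideanSpace ℝ (Fin N) => ζ ‖x‖)
      ((deriv ζ ‖x‖ / ‖x‖) • innerSL ℝ x) x := by
  by_cases hx : x = 0
  · subst hx
    have := (hasFDerivAt_const (𝕜 := ℝ) (0 : ℝ)
      (0 : EuclideanSpace ℝ (Fin N))).congr_of_eventuallyEq h.eventually_eq_zero
    simpa using this
  · have hx0 : 0 < ‖x‖ := norm_pos_iff.2 hx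
    have h1 : HasDerivAt ζ (deriv ζ ‖x‖) ‖x‖ :=
      ((h.contDiffAt hx0).differentiableAt (by simp)).hasDerivAt
    have h3 : HasFDerivAt (fun x : EuclideanSpace ℝ (Fin N) => ‖x‖) (‖x‖⁻¹ • innerSL ℝ x) x := by
      have h4 := (hasStrictFDerivAt_norm_sq x).hasFDerivAt.sqrt (by positivity)
      have h5 : (fun y : EuclideanSpace ℝ (Fin N) => Real.sqrt (‖y‖ ^ 2)) = fun y => ‖y‖ := by
        ext y; exact Real.sqrt_sq (norm_nonneg y)
      rw [h5] at h4
      refine h4.congr_fderiv ?_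
      ext v
      simp only [FunLike.coe_smul, Pi.smul_apply, innerSL_apply_apply, smul_eq_mul,
        Real.sqrt_sq (norm_nonneg x), nsmul_eq_mul]
      field_simp
      simp
    refine (h1.comp_hasFDerivAt x h3).congr_fderiv ?_
    rw [smul_smul, div_eq_mul_inv]

lemma fderiv_norm_apply (h : IsAnnularProfile ζ a b) (x v : EuclideanSpace ℝ (Fin N)) :
    fderiv ℝ (fun x : EuclideanSpace ℝ (Fin N) => ζ ‖x‖) x v =
      deriv ζ ‖x‖ / ‖x‖ * inner ℝ x v := by
  rw [(h.hasFDerivAt_norm x).fderiv]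
  simp

lemma deriv_eq_zero (h : IsAnnularProfile ζ a b) {r : ℝ} (hr : 0 < r) (hr' : r ∉ Set.Icc a b) :
    deriv ζ r = 0 := by
  have : ζ =ᶠ[𝓝 r] fun _ => 0 := by
    filter_upwards [isClosed_Icc.isOpen_compl.mem_nhds hr', Ioi_mem_nhds hr] with s hs hs0
    exact h.eq_zero s (le_of_lt hs0) hs
  rw [this.deriv_eq]
  simp

end IsAnnularProfile

/-! ### Weak derivatives on an interval -/

lemma integrable_mul_of_eq_zero {a b c d : ℝ} {h ψ : ℝ → ℝ}
    (hh : LocallyIntegrableOn h (Set.Ioo a b)) (hψ : Continuous ψ) (hc : a < c) (hd : d < b)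
    (hz : ∀ x, x ∉ Set.Icc c d → ψ x = 0) : Integrable (fun x => ψ x * h x) := by
  have h1 : IntegrableOn (fun x => ψ x * h x) (Set.Icc c d) :=
    (hh.integrableOn_compact_subset (fun x hx => ⟨hc.trans_le hx.1, hx.2.trans_lt hd⟩)
      isCompact_Icc).continuousOn_mul hψ.continuousOn isCompact_Icc
  rw [← integrableOn_iff_integrable_of_support_subset (s := Set.Icc c d)]
  · exact h1
  · intro x hx
    by_contra hx'
    exact hx (by simp [hz x hx'])

/-- The **du Bois-Reymond lemma**: a function whose distributional derivative vanishes on an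
interval is almost everywhere constant there. -/
lemma exists_ae_eq_const_of_integral_deriv_mul {a b : ℝ} (hab : a < b) {h : ℝ → ℝ}
    (hh : LocallyIntegrableOn h (Set.Ioo a b))
    (H : ∀ (η : ℝ → ℝ) (c d : ℝ), ContDiff ℝ ∞ η → a < c → d < b →
      (∀ x, x ∉ Set.Icc c d → η x = 0) → ∫ x, deriv η x * h x = 0) :
    ∃ k : ℝ, ∀ᵐ x : ℝ, x ∈ Set.Ioo a b → h x = k := by
  set m := (a + b) / 2 with hm
  set ε := (b - a) / 4 with hε
  have hε0 : 0 < ε := by rw [hε]; linarith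
  let B : ContDiffBump m := ⟨ε / 2, ε, by positivity, by linarith⟩
  set ρ : ℝ → ℝ := B.normed volume with hρ
  have hρc : ContDiff ℝ ∞ ρ := B.contDiff_normed
  have hρ0 : ∀ x, x ∉ Set.Icc (m - ε) (m + ε) → ρ x = 0 := by
    intro x hx
    by_contra hx'
    have : x ∈ Function.support ρ := hx'
    rw [hρ, B.support_normed_eq, Real.ball_eq_Ioo] at this
    exact hx (Set.Ioo_subset_Icc_self this)
  have hρ1 : ∫ x, ρ x = 1 := B.integral_normed
  have hma : a < m - ε := by rw [hm, hε]; linarith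
  have hmb : m + ε < b := by rw [hm, hε]; linarith
  have hρh := integrable_mul_of_eq_zero hh hρc.continuous hma hmb hρ0
  refine ⟨∫ x, ρ x * h x, ?_⟩
  have key := isOpen_Ioo.ae_eq_zero_of_integral_contDiff_smul_eq_zero
    (μ := volume) (U := Set.Ioo a b) (f := fun x => h x - ∫ y, ρ y * h y)
    (hh.sub (locallyIntegrableOn_const _)) ?_
  · filter_upwards [key] with x hx hx'
    linarith [hx hx']
  intro ψ hψ hψc hψs
  -- a test function is the derivative of a test function once its mean is removed
  obtain ⟨c, d, hc, hd, hψ0⟩ : ∃ c d, a < c ∧ d < b ∧ ∀ x, x ∉ Set.Icc c d → ψ x = 0 := by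
    by_cases hne : (tsupport ψ).Nonempty
    · have hK : IsCompact (tsupport ψ) := hψc
      refine ⟨sInf (tsupport ψ), sSup (tsupport ψ), (hψs (hK.sInf_mem hne)).1,
        (hψs (hK.sSup_mem hne)).2, fun x hx => ?_⟩
      by_contra hx'
      have hxs : x ∈ tsupport ψ := subset_tsupport _ hx'
      exact hx ⟨csInf_le hK.bddBelow hxs, le_csSup hK.bddAbove hxs⟩
    · refine ⟨m, m, by linarith, by linarith, fun x _ => ?_⟩
      by_contra hx'
      exact hne ⟨x, subset_tsupport _ hx'⟩
  set I := ∫ x, ψ x with hI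
  have hψi : Integrable ψ := hψ.continuous.integrable_of_hasCompactSupport hψc
  have hψh := integrable_mul_of_eq_zero hh hψ.continuous hc hd hψ0
  set ζ : ℝ → ℝ := fun x => ψ x - I * ρ x with hζ
  have hζc : ContDiff ℝ ∞ ζ := hψ.sub (contDiff_const.mul hρc)
  have hζi : Integrable ζ := hψi.sub (B.integrable_normed.const_mul I)
  have hζ1 : ∫ x, ζ x = 0 := by
    rw [hζ, integral_sub hψi (B.integrable_normed.const_mul I), integral_const_mul, ← hρ, hρ1]
    simp [hI]
  set c' := min c (m - ε) with hc'
  set d' := max d (m + ε) with hd'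
  have hζ0 : ∀ x, x ∉ Set.Icc c' d' → ζ x = 0 := by
    intro x hx
    have h1 : x ∉ Set.Icc c d := fun h' => hx
      ⟨(min_le_left _ _).trans h'.1, h'.2.trans (le_max_left _ _)⟩
    have h2 : x ∉ Set.Icc (m - ε) (m + ε) := fun h' => hx
      ⟨(min_le_right _ _).trans h'.1, h'.2.trans (le_max_right _ _)⟩
    simp [hζ, hψ0 x h1, hρ0 x h2]
  set η : ℝ → ℝ := fun x => ∫ t in a..x, ζ t with hη
  have hηd : ∀ x, HasDerivAt η (ζ x) x := fun x =>
    intervalIntegral.integral_hasDerivAt_right (hζc.continuous.intervalIntegrable _ _)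
      (hζc.continuous.stronglyMeasurableAtFilter _ _) hζc.continuous.continuousAt
  have hηd' : deriv η = ζ := funext fun x => (hηd x).deriv
  have hηc : ContDiff ℝ ∞ η := by
    rw [contDiff_infty_iff_deriv, hηd']
    exact ⟨fun x => (hηd x).differentiableAt, hζc⟩
  have hη0 : ∀ x, x ∉ Set.Icc c' d' → η x = 0 := by
    intro x hx
    by_cases hxc : x < c'
    · apply intervalIntegral.integral_zero_ae
      refine Eventually.of_forall fun t ht => hζ0 t fun ht' => ?_
      have h1 : t ≤ max a x := ht.2
      have h2 : a < c' := lt_min hc hma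
      have := max_lt h2 hxc
      linarith [ht'.1]
    · have hxd : d' < x := by
        by_contra h'
        exact hx ⟨not_lt.1 hxc, not_lt.1 h'⟩
      have hax : a ≤ x := by
        have h2 : a < c' := lt_min hc hma
        linarith
      rw [hη]
      simp only
      rw [intervalIntegral.integral_of_le hax, setIntegral_eq_integral_of_forall_compl_eq_zero, hζ1]
      intro t ht
      apply hζ0
      intro ht'
      exact ht ⟨(lt_min hc hma).trans_le ht'.1, ht'.2.trans hxd.le⟩
  have hfin := H η c' d' hηc (lt_min hc hma) (max_lt hd hmb) hη0
  rw [hηd'] at hfin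
  have e1 : ∫ x, ζ x * h x = (∫ x, ψ x * h x) - I * ∫ x, ρ x * h x := by
    rw [← integral_const_mul, ← integral_sub hψh (hρh.const_mul I)]
    congr 1 with x
    simp only [hζ]; ring
  have e2 : ∫ x, ψ x • (h x - ∫ y, ρ y * h y) = (∫ x, ψ x * h x) - I * ∫ x, ρ x * h x := by
    rw [hI, ← integral_mul_const, ← integral_sub hψh (hψi.mul_const _)]
    congr 1 with x
    simp only [smul_eq_mul]; ring
  rw [e2, ← e1, hfin]

/-- `f` is locally absolutely continuous on `(0, ∞)` with derivative `g`, expressed through the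
fundamental theorem of calculus. -/
structure IsPrimitive (f g : ℝ → ℝ) : Prop where
  intervalIntegrable : ∀ a b : ℝ, 0 < a → 0 < b → IntervalIntegrable g volume a b
  integral_eq : ∀ a b : ℝ, 0 < a → 0 < b → ∫ x in a..b, g x = f b - f a

namespace IsPrimitive

variable {f g : ℝ → ℝ}

lemma eq_add (h : IsPrimitive f g) {a x : ℝ} (ha : 0 < a) (hx : 0 < x) :
    f x = f a + ∫ t in a..x, g t := by
  rw [h.integral_eq a x ha hx]; ring

lemma absolutelyContinuousOnInterval (h : IsPrimitive f g) {a b : ℝ} (ha : 0 < a) (hb : 0 < b) :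
    AbsolutelyContinuousOnInterval f a b := by
  have h1 := (h.intervalIntegrable a b ha hb).absolutelyContinuousOnInterval_intervalIntegral
    (c := a) Set.left_mem_uIcc
  rw [absolutelyContinuousOnInterval_iff] at h1 ⊢
  intro ε hε
  obtain ⟨δ, hδ, h2⟩ := h1 ε hε
  refine ⟨δ, hδ, fun E hE hE' => lt_of_le_of_lt (le_of_eq ?_) (h2 E hE hE')⟩
  refine Finset.sum_congr rfl fun i hi => ?_
  have hpos : ∀ x ∈ Set.uIcc a b, 0 < x := fun x hx => (lt_min ha hb).trans_le hx.1
  have h3 := hE.1 i hi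
  rw [h.eq_add ha (hpos _ h3.1), h.eq_add ha (hpos _ h3.2), dist_add_left]

lemma ae_hasDerivAt (h : IsPrimitive f g) {a b : ℝ} (ha : 0 < a) (hb : 0 < b) :
    ∀ᵐ x, x ∈ Set.uIcc a b → HasDerivAt f (g x) x := by
  filter_upwards [(h.intervalIntegrable a b ha hb).ae_hasDerivAt_integral] with x hx hxm
  have hx0 : 0 < x := (lt_min ha hb).trans_le hxm.1
  have h1 := (hx hxm a Set.left_mem_uIcc).const_add (f a)
  refine h1.congr_of_eventuallyEq ?_
  filter_upwards [Ioi_mem_nhds hx0] with y hy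
  exact h.eq_add ha hy

lemma continuousOn (h : IsPrimitive f g) : ContinuousOn f (Set.Ioi 0) := by
  intro x hx
  have hx0 : (0 : ℝ) < x := hx
  have h1 := (h.absolutelyContinuousOnInterval (a := x / 2) (b := 2 * x) (by positivity)
    (by positivity)).continuousOn
  refine (h1.continuousAt ?_).continuousWithinAt
  rw [Set.uIcc_of_le (by linarith)]
  exact Icc_mem_nhds (by linarith) (by linarith)

/-- Integration by parts on a compact interval of positive radii. -/
lemma integral_mul_deriv (h : IsPrimitive f g) {a b : ℝ} (ha : 0 < a) (hb : 0 < b) {η : ℝ → ℝ}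
    (hη : AbsolutelyContinuousOnInterval η a b) :
    ∫ x in a..b, f x * deriv η x = f b * η b - f a * η a - ∫ x in a..b, g x * η x := by
  rw [(h.absolutelyContinuousOnInterval ha hb).integral_mul_deriv_eq_deriv_mul hη]
  congr 1
  apply intervalIntegral.integral_congr_ae
  filter_upwards [h.ae_hasDerivAt ha hb] with x hx hxm
  rw [(hx (Set.uIoc_subset_uIcc hxm)).deriv]

end IsPrimitive

/-- A function on `(0, R)` with weak derivative `g` agrees almost everywhere with a primitive
of `g`. -/
lemma exists_isPrimitive_of_weak_deriv {R : ℝ} (hR : 0 < R) {u g : ℝ → ℝ}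
    (hu : LocallyIntegrableOn u (Set.Ioo 0 R))
    (hg : ∀ a b : ℝ, 0 < a → 0 < b → IntervalIntegrable g volume a b)
    (H : ∀ (η : ℝ → ℝ) (c d : ℝ), ContDiff ℝ ∞ η → 0 < c → d < R →
      (∀ x, x ∉ Set.Icc c d → η x = 0) → ∫ x, deriv η x * u x = -∫ x, η x * g x) :
    ∃ f : ℝ → ℝ, IsPrimitive f g ∧ ∀ᵐ x : ℝ, x ∈ Set.Ioo 0 R → u x = f x := by
  set F : ℝ → ℝ := fun x => ∫ t in (R / 2)..x, g t with hF
  have hR2 : 0 < R / 2 := by positivity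
  have hFp : IsPrimitive F g := by
    refine ⟨hg, fun a b ha hb => ?_⟩
    rw [hF]
    exact (intervalIntegral.integral_interval_sub_left (hg _ _ hR2 hb) (hg _ _ hR2 ha)).symm
  have hFl : LocallyIntegrableOn F (Set.Ioo 0 R) :=
    (hFp.continuousOn.mono fun x hx => hx.1).locallyIntegrableOn measurableSet_Ioo
  obtain ⟨k, hk⟩ := exists_ae_eq_const_of_integral_deriv_mul hR (hu.sub hFl) (by
    intro η c d hη hc hd hz
    have hηd : Continuous (deriv η) := hη.continuous_deriv (by simp)
    have hzd : ∀ x, x ∉ Set.Icc c d → deriv η x = 0 := by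
      intro x hx
      have : η =ᶠ[𝓝 x] fun _ => 0 := by
        filter_upwards [isClosed_Icc.isOpen_compl.mem_nhds hx] with s hs using hz s hs
      rw [this.deriv_eq]
      simp
    have i1 := integrable_mul_of_eq_zero hu hηd hc hd hzd
    have i2 := integrable_mul_of_eq_zero hFl hηd hc hd hzd
    have e0 : ∫ x, deriv η x * (u - F) x =
        (∫ x, deriv η x * u x) - ∫ x, deriv η x * F x := by
      rw [← integral_sub i1 i2]
      congr 1 with x
      simp only [Pi.sub_apply]; ring
    rw [e0, H η c d hη hc hd hz]
    by_cases hcd : c ≤ d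
    swap
    · have hz' : ∀ x, η x = 0 := fun x => hz x (by simp [Set.Icc_eq_empty hcd])
      have hz'' : ∀ x, deriv η x = 0 := fun x => hzd x (by simp [Set.Icc_eq_empty hcd])
      simp [hz', hz'']
    set c' := c / 2 with hc'
    set d' := d + 1 with hd'
    have hc0 : 0 < c' := by positivity
    have hcd' : c' ≤ d' := by rw [hc', hd']; linarith
    have hout : ∀ t, t ∉ Set.Ioc c' d' → t ∉ Set.Icc c d := by
      intro t ht ht'
      exact ht ⟨by rw [hc']; linarith [ht'.1], by rw [hd']; linarith [ht'.2]⟩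
    have hηa : AbsolutelyContinuousOnInterval η c' d' :=
      ((hη.of_le (by simp)).contDiffOn).absolutelyContinuousOnInterval
    have := hFp.integral_mul_deriv hc0 (by linarith) hηa
    rw [hz c' (by rw [hc']; intro h; linarith [h.1]), hz d' (by rw [hd']; intro h; linarith [h.2]),
      intervalIntegral.integral_of_le hcd', intervalIntegral.integral_of_le hcd',
      setIntegral_eq_integral_of_forall_compl_eq_zero,
      setIntegral_eq_integral_of_forall_compl_eq_zero] at this
    · have e1 : ∫ x, deriv η x * F x = ∫ x, F x * deriv η x := by
        congr 1 with x; ring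
      have e2 : ∫ x, η x * g x = ∫ x, g x * η x := by
        congr 1 with x; ring
      rw [e1, e2, this]; ring
    · intro t ht
      rw [hz t (hout t ht), mul_zero]
    · intro t ht
      rw [hzd t (hout t ht), mul_zero])
  refine ⟨fun x => F x + k, ⟨hg, fun a b ha hb => ?_⟩, ?_⟩
  · rw [hFp.integral_eq a b ha hb]; ring
  · filter_upwards [hk] with x hx hxm
    have := hx hxm
    simp only [Pi.sub_apply] at this
    linarith

/-! ### Absolutely continuous profiles of radial Sobolev functions -/

/-- `(f, g)` is a radial profile of `w = (u, ∇u)`: `f` is a locally absolutely continuous function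
on `(0, ∞)` with `u(x) = f(|x|)`, its derivative is `g`, and the energy of `g` is controlled by
that of `∇u`. -/
structure IsRadialProfile {N : ℕ} {R : ℝ} (w : L2Pair N R) (f g : ℝ → ℝ) : Prop where
  isPrimitive : IsPrimitive f g
  measurable : Measurable g
  coe_eq : ∀ᵐ x ∂(ballMeasure N R), w.1 x = f ‖x‖
  integrable_sq : Integrable (fun x => g ‖x‖ ^ 2) (ballMeasure N R)
  energy_le : ∫ x, g ‖x‖ ^ 2 ∂(ballMeasure N R) ≤ ∫ x, ‖w.2 x‖ ^ 2 ∂(ballMeasure N R)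

/-- The radial component of a square integrable vector field. -/
def radialComponent {N : ℕ} {R : ℝ} (G : Lp (EuclideanSpace ℝ (Fin N)) 2 (ballMeasure N R))
    (x : EuclideanSpace ℝ (Fin N)) : ℝ :=
  inner ℝ (G x) (‖x‖⁻¹ • x)

lemma abs_radialComponent_le {N : ℕ} {R : ℝ}
    (G : Lp (EuclideanSpace ℝ (Fin N)) 2 (ballMeasure N R)) (x : EuclideanSpace ℝ (Fin N)) :
    |radialComponent G x| ≤ ‖G x‖ := by
  refine (abs_real_inner_le_norm _ _).trans (mul_le_of_le_one_right (norm_nonneg _) ?_)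
  rw [norm_smul, norm_inv, norm_norm]
  exact inv_mul_le_one

lemma memLp_radialComponent {N : ℕ} {R : ℝ}
    (G : Lp (EuclideanSpace ℝ (Fin N)) 2 (ballMeasure N R)) :
    MemLp (radialComponent G) 2 (ballMeasure N R) := by
  refine (Lp.memLp G).mono ?_ (Eventually.of_forall fun x => by
    rw [Real.norm_eq_abs]; exact abs_radialComponent_le G x)
  refine (Lp.memLp G).1.inner (Measurable.aestronglyMeasurable ?_)
  exact measurable_norm.inv.smul measurable_id

/-- Testing the weak gradient with the radial vector field `ζ(|x|) x`. -/
lemma integral_mul_radial_divergence {N : ℕ} {R : ℝ} {u : Lp ℝ 2 (ballMeasure N R)}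
    {G : Lp (EuclideanSpace ℝ (Fin N)) 2 (ballMeasure N R)} (hG : IsWeakGradient u G)
    {ζ : ℝ → ℝ} {c d : ℝ} (hζ : IsAnnularProfile ζ c d) (hd : d < R) :
    ∫ x, u x * (N * ζ ‖x‖ + ‖x‖ * deriv ζ ‖x‖) ∂(ballMeasure N R) =
      -∫ x, radialComponent G x * (‖x‖ * ζ ‖x‖) ∂(ballMeasure N R) := by
  set φ : Fin N → EuclideanSpace ℝ (Fin N) → ℝ := fun i x => x i * ζ ‖x‖ with hφ
  set e : Fin N → EuclideanSpace ℝ (Fin N) := fun i => EuclideanSpace.single i (1 : ℝ) with he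
  have hcoord : ∀ i, ContDiff ℝ ∞ (fun x : EuclideanSpace ℝ (Fin N) => x i) := fun i =>
    (EuclideanSpace.proj (𝕜 := ℝ) i).contDiff
  have hφc : ∀ i, ContDiff ℝ ∞ (φ i) := fun i => (hcoord i).mul hζ.contDiff_norm
  have hφs : ∀ i, HasCompactSupport (φ i) := fun i => hζ.hasCompactSupport_norm.mul_left
  have hφt : ∀ i, tsupport (φ i) ⊆ Metric.ball 0 R := fun i =>
    (tsupport_mul_subset_right).trans
      (hζ.tsupport_norm_subset.trans (Metric.closedBall_subset_ball hd))
  have hφd : ∀ i x, fderiv ℝ (φ i) x (e i) =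
      x i * (deriv ζ ‖x‖ / ‖x‖ * x i) + ζ ‖x‖ := by
    intro i x
    have h1 := ((EuclideanSpace.proj (𝕜 := ℝ) i).hasFDerivAt (x := x)).mul (hζ.hasFDerivAt_norm x)
    have h2 : fderiv ℝ (φ i) x = _ := h1.fderiv
    rw [h2]
    simp [he, EuclideanSpace.inner_single_right]
  have h1 : ∀ i, ∫ x, u x * fderiv ℝ (φ i) x (e i) ∂(ballMeasure N R) =
      -∫ x, inner ℝ (G x) (e i) * φ i x ∂(ballMeasure N R) := fun i =>
    hG (φ i) (hφc i) (hφs i) (hφt i) (e i)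
  have h2 := Finset.sum_congr rfl fun i (_ : i ∈ Finset.univ) => h1 i
  rw [Finset.sum_neg_distrib, ← integral_finsetSum _ fun i _ =>
    integrable_left u (hφc i) (hφs i) (e i), ← integral_finsetSum _ fun i _ =>
    integrable_right G (hφc i) (hφs i) (e i)] at h2
  have hsq : ∀ x : EuclideanSpace ℝ (Fin N), ∑ i, x i * x i = ‖x‖ ^ 2 := by
    intro x
    rw [EuclideanSpace.real_norm_sq_eq]
    exact Finset.sum_congr rfl fun i _ => by ring
  have e1 : ∀ x, u x * (N * ζ ‖x‖ + ‖x‖ * deriv ζ ‖x‖) =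
      ∑ i, u x * fderiv ℝ (φ i) x (e i) := by
    intro x
    rw [← Finset.mul_sum]
    congr 1
    simp_rw [hφd]
    rw [Finset.sum_add_distrib, Finset.sum_const, Finset.card_univ, Fintype.card_fin, nsmul_eq_mul]
    have : ∑ i, x i * (deriv ζ ‖x‖ / ‖x‖ * x i) = deriv ζ ‖x‖ / ‖x‖ * ∑ i, x i * x i := by
      rw [Finset.mul_sum]
      exact Finset.sum_congr rfl fun i _ => by ring
    rw [this, hsq]
    by_cases hx : ‖x‖ = 0
    · simp [hx]
    · field_simp
      ring
  have e2 : ∀ x, radialComponent G x * (‖x‖ * ζ ‖x‖) = ∑ i, inner ℝ (G x) (e i) * φ i x := by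
    intro x
    have h3 : ∑ i, inner ℝ (G x) (e i) * φ i x = inner ℝ (G x) x * ζ ‖x‖ := by
      simp only [he, hφ, PiLp.inner_apply, Finset.sum_mul]
      refine Finset.sum_congr rfl fun i _ => ?_
      simp
      ring
    rw [h3, radialComponent, inner_smul_right]
    by_cases hx : ‖x‖ = 0
    · rw [norm_eq_zero] at hx
      simp [hx]
    · field_simp
  simp_rw [e1, e2]
  exact h2

/-- Averaging over the level sets of `ρ`: the conditional expectation of `F` given `ρ` is a
function `g` of `ρ`. -/
lemma exists_average_on_level_sets {Ω : Type*} [m₀ : MeasurableSpace Ω] {μ : Measure Ω}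
    [IsFiniteMeasure μ] {ρ : Ω → ℝ} (hρ : Measurable ρ) {F : Ω → ℝ} (hF : MemLp F 2 μ) :
    ∃ g : ℝ → ℝ, Measurable g ∧ MemLp (fun x => g (ρ x)) 2 μ ∧
      ∫ x, g (ρ x) ^ 2 ∂μ ≤ ∫ x, F x ^ 2 ∂μ ∧
      ∀ (k : ℝ → ℝ) (C : ℝ), Measurable k → (∀ x, ‖k (ρ x)‖ ≤ C) →
        ∫ x, F x * k (ρ x) ∂μ = ∫ x, g (ρ x) * k (ρ x) ∂μ := by
  obtain ⟨g, hg, hg'⟩ : ∃ g : ℝ → ℝ, StronglyMeasurable g ∧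
      μ[F | MeasurableSpace.comap ρ inferInstance] = g ∘ ρ :=
    stronglyMeasurable_condExp.exists_eq_measurable_comp
  have hgx : ∀ x, (μ[F | MeasurableSpace.comap ρ inferInstance]) x = g (ρ x) := fun x => by
    rw [hg']; rfl
  have hsq : Integrable (fun x => ‖F x‖ ^ (2 : ℝ)) μ := by
    have := hF.integrable_norm_rpow (by norm_num) (by norm_num)
    simpa using this
  have hFi : Integrable F μ := hF.integrable (by norm_num)
  refine ⟨g, hg.measurable, ?_, ?_, ?_⟩
  · have := hF.condExp (m := MeasurableSpace.comap ρ inferInstance) (by norm_num)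
    rwa [hg'] at this
  · have := integral_norm_condExp_rpow_le (m := MeasurableSpace.comap ρ inferInstance)
      (by norm_num) hsq
    simpa [hgx] using this
  · intro k C hk hC
    have hkF : Integrable (F * fun x => k (ρ x)) μ :=
      hFi.mul_bdd (c := C) (hk.comp hρ).aestronglyMeasurable (Eventually.of_forall hC)
    have hks : StronglyMeasurable[MeasurableSpace.comap ρ inferInstance] fun x => k (ρ x) :=
      (hk.comp (comap_measurable ρ)).stronglyMeasurable
    have h1 := condExp_mul_of_stronglyMeasurable_right hks hkF hFi
    calc ∫ x, F x * k (ρ x) ∂μ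
        = ∫ x, (μ[F * fun x => k (ρ x) | MeasurableSpace.comap ρ inferInstance]) x ∂μ :=
          (integral_condExp hρ.comap_le).symm
      _ = ∫ x, g (ρ x) * k (ρ x) ∂μ := by
          apply integral_congr_ae
          filter_upwards [h1] with x hx
          rw [hx, Pi.mul_apply, hgx]

/-- Functions in `H¹_rad(B_R)` are absolutely continuous in the radius. The derivative of the
profile is the conditional expectation of the radial component of the gradient, given `|x|`. -/
theorem exists_isRadialProfile {N : ℕ} (hN : 1 ≤ N) {R : ℝ} (hR : 0 < R) {w : L2Pair N R}
    (hw : w ∈ H1rad N R) : ∃ f g, IsRadialProfile w f g := by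
  obtain ⟨⟨f₀, hf₀, hu⟩, hG⟩ := hw
  set μ := ballMeasure N R with hμ
  set Gr := radialComponent w.2 with hGr
  have hGr2 : MemLp Gr 2 μ := memLp_radialComponent w.2
  obtain ⟨g₁, hg₁, hg₁L, hg₁e, hg₁k⟩ := exists_average_on_level_sets measurable_norm hGr2
  set g : ℝ → ℝ := (Set.Ioo 0 R).indicator g₁ with hg
  have hgm : Measurable g := hg₁.indicator measurableSet_Ioo
  have hgg : ∀ᵐ x ∂μ, g ‖x‖ = g₁ ‖x‖ :=
    ae_ball_of_ae_Ioo (P := fun r => g r = g₁ r) hN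
      (Eventually.of_forall fun r hr => by rw [hg, Set.indicator_of_mem hr])
  have hgL : MemLp (fun x => g ‖x‖) 2 μ :=
    hg₁L.ae_eq (by filter_upwards [hgg] with x hx using hx.symm)
  have hgsq : Integrable (fun x => g ‖x‖ ^ 2) μ := hgL.integrable_sq
  have henergy : ∫ x, g ‖x‖ ^ 2 ∂μ ≤ ∫ x, ‖w.2 x‖ ^ 2 ∂μ := by
    calc ∫ x, g ‖x‖ ^ 2 ∂μ = ∫ x, g₁ ‖x‖ ^ 2 ∂μ := by
          apply integral_congr_ae
          filter_upwards [hgg] with x hx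
          rw [hx]
      _ ≤ ∫ x, Gr x ^ 2 ∂μ := hg₁e
      _ ≤ ∫ x, ‖w.2 x‖ ^ 2 ∂μ := by
          apply integral_mono hGr2.integrable_sq
            ((Lp.memLp w.2).integrable_norm_pow (by norm_num))
          intro x
          simp only
          rw [← sq_abs]
          exact pow_le_pow_left₀ (abs_nonneg _) (abs_radialComponent_le w.2 x) 2
  -- local integrability of `f₀` and `g` on the half-line
  have hpow : ∀ {a b : ℝ} {h : ℝ → ℝ}, 0 < a →
      IntegrableOn (fun r => r ^ (N - 1) * h r) (Set.Icc a b) → IntegrableOn h (Set.Icc a b) := by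
    intro a b h ha hi
    have h1 := hi.continuousOn_mul (g' := fun r => r ^ (N - 1) * h r)
      (g := fun r : ℝ => (r ^ (N - 1))⁻¹)
      (ContinuousOn.inv₀ (by fun_prop) fun r hr =>
        pow_ne_zero _ (ha.trans_le hr.1).ne') isCompact_Icc
    refine h1.congr_fun (fun r hr => ?_) measurableSet_Icc
    have : r ^ (N - 1) ≠ 0 := pow_ne_zero _ (ha.trans_le hr.1).ne'
    field_simp
  have hf₀i : IntegrableOn (fun r => r ^ (N - 1) * f₀ r) (Set.Ioo 0 R) := by
    rw [← integrable_ball_radial hN]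
    exact ((Lp.memLp w.1).integrable (by norm_num)).congr hu
  have hf₀l : LocallyIntegrableOn f₀ (Set.Ioo 0 R) := by
    rw [locallyIntegrableOn_iff isOpen_Ioo.isLocallyClosed]
    intro k hk hkc
    by_cases hne : k.Nonempty
    · have h1 := hk (hkc.sInf_mem hne)
      have h2 := hk (hkc.sSup_mem hne)
      refine (hpow h1.1 (hf₀i.mono_set ?_)).mono_set (fun x hx =>
        ⟨csInf_le hkc.bddBelow hx, le_csSup hkc.bddAbove hx⟩)
      exact fun x hx => ⟨h1.1.trans_le hx.1, hx.2.trans_lt h2.2⟩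
    · rw [Set.not_nonempty_iff_eq_empty.1 hne]; exact integrableOn_empty
  have hgi : ∀ a b : ℝ, 0 < a → 0 < b → IntervalIntegrable g volume a b := by
    have h1 : IntegrableOn (fun r => r ^ (N - 1) * g r) (Set.Ioo 0 R) := by
      rw [← integrable_ball_radial hN]
      exact hgL.integrable (by norm_num)
    have h2 : Integrable (fun r => r ^ (N - 1) * g r) := by
      rw [← integrableOn_iff_integrable_of_support_subset (s := Set.Ioo 0 R)]
      · exact h1
      · intro r hr
        by_contra hr'
        exact hr (by simp [hg, hr'])
    intro a b ha hb
    rw [intervalIntegrable_iff]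
    exact (hpow (lt_min ha hb) h2.integrableOn).mono_set Set.uIoc_subset_uIcc
  obtain ⟨f, hfg, hf⟩ := exists_isPrimitive_of_weak_deriv hR hf₀l hgi (by
    intro η c d hη hc hd hz
    set ζ : ℝ → ℝ := fun r => η r * (r ^ N)⁻¹ with hζ
    have hζp : IsAnnularProfile ζ c d := by
      refine ⟨hη.contDiffOn.mul (ContDiffOn.inv (by fun_prop) fun r hr =>
        pow_ne_zero _ (ne_of_gt hr)), fun r _ hr' => ?_, hc⟩
      simp [hζ, hz r hr']
    have hzd : ∀ x, x ∉ Set.Icc c d → deriv η x = 0 := by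
      intro x hx
      have : η =ᶠ[𝓝 x] fun _ => 0 := by
        filter_upwards [isClosed_Icc.isOpen_compl.mem_nhds hx] with s hs using hz s hs
      rw [this.deriv_eq]
      simp
    have hNp : ∀ r : ℝ, r ^ N = r ^ (N - 1) * r := fun r => by
      rw [← pow_succ, Nat.sub_add_cancel hN]
    have key := integral_mul_radial_divergence hG hζp hd
    set k : ℝ → ℝ := fun r => r * ζ r with hk
    have hkm : Measurable k := by
      have := hη.continuous.measurable
      simp only [hk, hζ]
      fun_prop
    have hkb : ∃ C, ∀ x : EuclideanSpace ℝ (Fin N), ‖k ‖x‖‖ ≤ C :=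
      Continuous.bounded_above_of_compact_support
        (continuous_norm.mul hζp.contDiff_norm.continuous) hζp.hasCompactSupport_norm.mul_left
    obtain ⟨C, hC⟩ := hkb
    have hcond : ∫ x, Gr x * (‖x‖ * ζ ‖x‖) ∂μ = ∫ x, g ‖x‖ * k ‖x‖ ∂μ := by
      rw [hg₁k k C hkm hC]
      apply integral_congr_ae
      filter_upwards [hgg] with x hx
      rw [hx]
    have e1 : ∫ x, w.1 x * (N * ζ ‖x‖ + ‖x‖ * deriv ζ ‖x‖) ∂μ =
        ∫ x, (fun r => f₀ r * (N * ζ r + r * deriv ζ r)) ‖x‖ ∂μ := by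
      apply integral_congr_ae
      filter_upwards [hu] with x hx
      rw [hx]
    rw [e1, hcond, hμ, integral_ball_radial hN R (fun r => f₀ r * (N * ζ r + r * deriv ζ r)),
      integral_ball_radial hN R (fun r => g r * k r),
      ← mul_neg] at key
    have key' := mul_left_cancel₀ (sphereArea_pos hN).ne' key
    have hIoo : ∀ r : ℝ, r ∉ Set.Ioo 0 R → r ∉ Set.Icc c d := fun r hr hr' =>
      hr ⟨hc.trans_le hr'.1, hr'.2.trans_lt hd⟩
    have e2 : ∫ r in Set.Ioo 0 R, r ^ (N - 1) * (f₀ r * (N * ζ r + r * deriv ζ r)) =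
        ∫ x, deriv η x * f₀ x := by
      rw [← setIntegral_eq_integral_of_forall_compl_eq_zero (s := Set.Ioo 0 R) (f :=
        fun x => deriv η x * f₀ x) fun r hr => by rw [hzd r (hIoo r hr), zero_mul]]
      refine setIntegral_congr_fun measurableSet_Ioo fun r hr => ?_
      have hr0 : r ≠ 0 := hr.1.ne'
      have hd1 : HasDerivAt ζ (deriv η r * (r ^ N)⁻¹ +
          η r * (-(N * r ^ (N - 1)) / (r ^ N) ^ 2)) r :=
        ((hη.differentiable (by simp)) r).hasDerivAt.mul
          ((hasDerivAt_pow N r).inv (pow_ne_zero _ hr0))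
      simp only [hd1.deriv]
      simp only [hζ, hNp r]
      field_simp
      ring
    have e3 : ∫ r in Set.Ioo 0 R, r ^ (N - 1) * (g r * k r) = ∫ x, η x * g x := by
      rw [← setIntegral_eq_integral_of_forall_compl_eq_zero (s := Set.Ioo 0 R) (f :=
        fun x => η x * g x) fun r hr => by rw [hz r (hIoo r hr), zero_mul]]
      refine setIntegral_congr_fun measurableSet_Ioo fun r hr => ?_
      have hr0 : r ≠ 0 := hr.1.ne'
      simp only [hk, hζ, hNp r]
      field_simp
    rw [← e2, key', e3])
  refine ⟨f, g, hfg, hgm, ?_, hgsq, henergy⟩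
  filter_upwards [hu, ae_ball_of_ae_Ioo (P := fun r => f₀ r = f r) hN hf] with x h1 h2
  rw [h1, h2]

/-! ### Hardy and Poincaré inequalities for profiles -/

namespace IsPrimitive

variable {f g : ℝ → ℝ}

lemma sub_const (h : IsPrimitive f g) (k : ℝ) : IsPrimitive (fun x => f x - k) g :=
  ⟨h.intervalIntegrable, fun a b ha hb => by rw [h.integral_eq a b ha hb]; ring⟩

lemma continuousOn_uIcc (h : IsPrimitive f g) {a b : ℝ} (ha : 0 < a) (hb : 0 < b) :
    ContinuousOn f (Set.uIcc a b) :=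
  h.continuousOn.mono fun _ hx => (lt_min ha hb).trans_le hx.1

lemma intervalIntegrable_deriv_sq_mul_pow (h : IsPrimitive f g) (n : ℕ) {a b : ℝ} (ha : 0 < a)
    (hb : 0 < b) : IntervalIntegrable
      (fun x => 2 * f x * g x * x ^ (n + 1) + (n + 1) * (f x ^ 2 * x ^ n)) volume a b := by
  have hf := h.continuousOn_uIcc ha hb
  have h1 : IntervalIntegrable (fun x => g x * (2 * f x * x ^ (n + 1))) volume a b :=
    (h.intervalIntegrable a b ha hb).mul_continuousOn (by fun_prop)
  have h2 : IntervalIntegrable (fun x => ((n : ℝ) + 1) * (f x ^ 2 * x ^ n)) volume a b :=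
    ContinuousOn.intervalIntegrable (by fun_prop)
  refine (h1.add h2).congr fun x _ => ?_
  ring

lemma integral_deriv_sq_mul_pow (h : IsPrimitive f g) (n : ℕ) {a b : ℝ} (ha : 0 < a)
    (hb : 0 < b) :
    ∫ x in a..b, (2 * f x * g x * x ^ (n + 1) + (n + 1) * (f x ^ 2 * x ^ n)) =
      f b ^ 2 * b ^ (n + 1) - f a ^ 2 * a ^ (n + 1) := by
  have hf := h.absolutelyContinuousOnInterval ha hb
  have hp : AbsolutelyContinuousOnInterval (fun x : ℝ => x ^ (n + 1)) a b :=
    ContDiffOn.absolutelyContinuousOnInterval (by fun_prop)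
  have h1 := ((hf.fun_mul hf).fun_mul hp).integral_deriv_eq_sub
  have h2 : ∀ x, f x ^ 2 * x ^ (n + 1) = f x * f x * x ^ (n + 1) := fun x => by ring
  rw [h2, h2, ← h1]
  apply intervalIntegral.integral_congr_ae
  filter_upwards [h.ae_hasDerivAt ha hb] with x hx hxm
  have h3 := hx (Set.uIoc_subset_uIcc hxm)
  have h4 := ((h3.fun_mul h3).fun_mul (hasDerivAt_pow (n + 1) x)).deriv
  rw [h4]
  push_cast
  ring

/-- **Hardy's inequality** in dimension `n + 3` on an interval at whose right end `f` vanishes. With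
`κ = (n + 1) / 2`, the integral of `x ^ n * (x * g x + κ * f x) ^ 2` is nonnegative, and its mixed
term is the derivative of `f ^ 2 * x ^ (n + 1)` up to a multiple of `x ^ n * f ^ 2`. -/
lemma hardy_of_pos (h : IsPrimitive f g) (n : ℕ) {a b : ℝ} (ha : 0 < a) (hab : a ≤ b)
    (hfb : f b = 0) (hg : IntervalIntegrable (fun x => x ^ (n + 2) * g x ^ 2) volume a b) :
    (((n : ℝ) + 1) / 2) ^ 2 * ∫ x in a..b, x ^ n * f x ^ 2 ≤
      ∫ x in a..b, x ^ (n + 2) * g x ^ 2 := by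
  have hb : 0 < b := ha.trans_le hab
  have hf := h.continuousOn_uIcc ha hb
  set κ : ℝ := ((n : ℝ) + 1) / 2 with hκ
  have hκ0 : 0 ≤ κ := by positivity
  have hD := h.intervalIntegrable_deriv_sq_mul_pow n ha hb
  have hF : IntervalIntegrable (fun x => x ^ n * f x ^ 2) volume a b :=
    ContinuousOn.intervalIntegrable (by fun_prop)
  have h0 : 0 ≤ ∫ x in a..b, (x ^ (n + 2) * g x ^ 2 +
      κ * (2 * f x * g x * x ^ (n + 1) + (n + 1) * (f x ^ 2 * x ^ n)) -
      κ ^ 2 * (x ^ n * f x ^ 2)) := by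
    apply intervalIntegral.integral_nonneg hab
    intro x hx
    have hx0 : 0 ≤ x := ha.le.trans hx.1
    have hn : (n : ℝ) + 1 = 2 * κ := by rw [hκ]; ring
    have : x ^ (n + 2) * g x ^ 2 +
      κ * (2 * f x * g x * x ^ (n + 1) + (n + 1) * (f x ^ 2 * x ^ n)) -
      κ ^ 2 * (x ^ n * f x ^ 2) = x ^ n * (x * g x + κ * f x) ^ 2 := by
      rw [hn]; ring
    rw [this]
    positivity
  rw [intervalIntegral.integral_sub (hg.add (hD.const_mul κ)) (hF.const_mul _),
    intervalIntegral.integral_add hg (hD.const_mul κ), intervalIntegral.integral_const_mul,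
    intervalIntegral.integral_const_mul, h.integral_deriv_sq_mul_pow n ha hb, hfb] at h0
  have : 0 ≤ κ * (f a ^ 2 * a ^ (n + 1)) := by positivity
  nlinarith

lemma integrableOn_pow_mul_sq_of_eq_zero (h : IsPrimitive f g) (n : ℕ) {b : ℝ} (hb : 0 < b)
    (hfb : f b = 0) (hg : IntegrableOn (fun x => x ^ (n + 2) * g x ^ 2) (Set.Ioc 0 b)) :
    IntegrableOn (fun x => x ^ n * f x ^ 2) (Set.Ioc 0 b) := by
  have hκ0 : 0 < (((n : ℝ) + 1) / 2) ^ 2 := by positivity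
  have hFi : ∀ a : ℝ, 0 < a → IntegrableOn (fun x => x ^ n * f x ^ 2) (Set.Ioc a b) := by
    intro a ha
    have hc : ContinuousOn (fun x => x ^ n * f x ^ 2) (Set.Icc a b) := by
      have := h.continuousOn.mono fun x (hx : x ∈ Set.Icc a b) => ha.trans_le hx.1
      fun_prop
    exact (hc.integrableOn_compact isCompact_Icc).mono_set Set.Ioc_subset_Icc_self
  have hseq : ∀ i : ℕ, (0 : ℝ) < 1 / ((i : ℝ) + 1) := fun i => by positivity
  refine integrableOn_Ioc_of_intervalIntegral_norm_bounded_left (l := atTop)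
    (a := fun i : ℕ => 1 / ((i : ℝ) + 1))
    (I := ((((n : ℝ) + 1) / 2) ^ 2)⁻¹ * ∫ x in Set.Ioc 0 b, x ^ (n + 2) * g x ^ 2)
    (fun i => hFi _ (hseq i)) tendsto_one_div_add_atTop_nhds_zero_nat ?_
  have hev := tendsto_one_div_add_atTop_nhds_zero_nat.eventually (Iio_mem_nhds hb)
  filter_upwards [hev] with i hi
  have hi' : 1 / ((i : ℝ) + 1) ≤ b := le_of_lt hi
  have hgi : IntegrableOn (fun x => x ^ (n + 2) * g x ^ 2) (Set.Ioc (1 / ((i : ℝ) + 1)) b) :=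
    hg.mono_set (Set.Ioc_subset_Ioc_left (hseq i).le)
  have h1 := h.hardy_of_pos n (hseq i) hi' hfb
    ((intervalIntegrable_iff_integrableOn_Ioc_of_le hi').2 hgi)
  rw [intervalIntegral.integral_of_le hi', intervalIntegral.integral_of_le hi'] at h1
  have h2 : ∫ x in Set.Ioc (1 / ((i : ℝ) + 1)) b, ‖x ^ n * f x ^ 2‖ =
      ∫ x in Set.Ioc (1 / ((i : ℝ) + 1)) b, x ^ n * f x ^ 2 := by
    refine setIntegral_congr_fun measurableSet_Ioc fun x hx => ?_
    have : 0 ≤ x := (hseq i).le.trans hx.1.le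
    simp only [Real.norm_eq_abs]
    exact abs_of_nonneg (by positivity)
  have h3 : ∫ x in Set.Ioc (1 / ((i : ℝ) + 1)) b, x ^ (n + 2) * g x ^ 2 ≤
      ∫ x in Set.Ioc 0 b, x ^ (n + 2) * g x ^ 2 := by
    refine setIntegral_mono_set hg ?_ (Set.Ioc_subset_Ioc_left (hseq i).le).eventuallyLE
    filter_upwards [ae_restrict_mem measurableSet_Ioc] with x hx
    have : 0 ≤ x := hx.1.le
    simp only [Pi.zero_apply]
    positivity
  rw [h2, inv_mul_eq_div, le_div_iff₀ hκ0]
  linarith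

/-- **Hardy's inequality** on `(0, b)` for profiles that vanish at `b`. -/
lemma hardy (h : IsPrimitive f g) (n : ℕ) {b : ℝ} (hb : 0 < b)
    (hfb : f b = 0) (hg : IntegrableOn (fun x => x ^ (n + 2) * g x ^ 2) (Set.Ioc 0 b)) :
    (((n : ℝ) + 1) / 2) ^ 2 * ∫ x in 0..b, x ^ n * f x ^ 2 ≤
      ∫ x in 0..b, x ^ (n + 2) * g x ^ 2 := by
  have hF := h.integrableOn_pow_mul_sq_of_eq_zero n hb hfb hg
  have hlim : ∀ {F : ℝ → ℝ}, IntegrableOn F (Set.Ioc 0 b) →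
      Tendsto (fun a => ∫ x in a..b, F x) (𝓝[>] 0) (𝓝 (∫ x in 0..b, F x)) := by
    intro F hFi
    have h1 : ContinuousOn (fun a => ∫ x in b..a, F x) (Set.uIcc 0 b) :=
      intervalIntegral.continuousOn_primitive_interval'
        ((intervalIntegrable_iff_integrableOn_Ioc_of_le hb.le).2 hFi) Set.right_mem_uIcc
    have h2 := (h1 0 Set.left_mem_uIcc).neg
    have h3 : Tendsto (fun a => ∫ x in a..b, F x) (𝓝[Set.uIcc 0 b] 0)
        (𝓝 (∫ x in 0..b, F x)) := by
      rw [intervalIntegral.integral_symm b 0]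
      exact h2.tendsto.congr fun a => (intervalIntegral.integral_symm _ _).symm
    refine h3.mono_left ?_
    rw [← nhdsWithin_Ioo_eq_nhdsGT hb]
    refine nhdsWithin_mono _ ?_
    rw [Set.uIcc_of_le hb.le]
    exact Set.Ioo_subset_Icc_self
  refine le_of_tendsto_of_tendsto ((hlim hF).const_mul _) (hlim hg) ?_
  filter_upwards [Ioo_mem_nhdsGT hb] with a ha
  refine h.hardy_of_pos n ha.1 ha.2.le hfb ?_
  exact (intervalIntegrable_iff_integrableOn_Ioc_of_le ha.2.le).2
    (hg.mono_set (Set.Ioc_subset_Ioc_left ha.1.le))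

lemma integrableOn_pow_mul_sq (h : IsPrimitive f g) (n : ℕ) {b : ℝ} (hb : 0 < b)
    (hg : IntegrableOn (fun x => x ^ (n + 2) * g x ^ 2) (Set.Ioc 0 b)) :
    IntegrableOn (fun x => x ^ n * f x ^ 2) (Set.Ioc 0 b) := by
  have h1 := (h.sub_const (f b)).integrableOn_pow_mul_sq_of_eq_zero n hb (by simp) hg
  have h2 : IntegrableOn (fun x : ℝ => x ^ n * f b ^ 2) (Set.Ioc 0 b) :=
    (Continuous.integrableOn_Icc (by fun_prop)).mono_set Set.Ioc_subset_Icc_self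
  refine Integrable.mono' ((h1.const_mul 2).add (h2.const_mul 2)) ?_ ?_
  · refine ContinuousOn.aestronglyMeasurable ?_ measurableSet_Ioc
    have := h.continuousOn.mono fun x (hx : x ∈ Set.Ioc 0 b) => hx.1
    fun_prop
  · filter_upwards [ae_restrict_mem measurableSet_Ioc] with x hx
    have hx0 : 0 ≤ x := hx.1.le
    rw [Real.norm_eq_abs, abs_of_nonneg (by positivity)]
    simp only [Pi.add_apply]
    have : 0 ≤ x ^ n * (f x - 2 * f b) ^ 2 := by positivity
    nlinarith

/-- **Poincaré's inequality** on an interval of positive radii, for profiles with a zero. -/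
lemma poincare (h : IsPrimitive f g) {a b s : ℝ} (ha : 0 < a) (hs : s ∈ Set.Icc a b)
    (hfs : f s = 0) (hg : IntervalIntegrable (fun x => g x ^ 2) volume a b) :
    ∫ x in a..b, f x ^ 2 ≤ (b - a) ^ 2 * ∫ x in a..b, g x ^ 2 := by
  have hab : a ≤ b := hs.1.trans hs.2
  have hb : 0 < b := ha.trans_le hab
  have key : ∀ x ∈ Set.Icc a b, f x ^ 2 ≤ (b - a) * ∫ x in a..b, g x ^ 2 := by
    have hcs : ∀ c d : ℝ, a ≤ c → c ≤ d → d ≤ b →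
        (f d - f c) ^ 2 ≤ (b - a) * ∫ x in a..b, g x ^ 2 := by
      intro c d hc hcd hd
      have hsub : Set.uIcc c d ⊆ Set.uIcc a b := by
        rw [Set.uIcc_of_le hcd, Set.uIcc_of_le hab]
        exact Set.Icc_subset_Icc hc hd
      have hg' := hg.mono_set hsub
      have hi := h.intervalIntegrable c d (ha.trans_le hc) (ha.trans_le (hc.trans hcd))
      have hmono : ∫ x in c..d, g x ^ 2 ≤ ∫ x in a..b, g x ^ 2 :=
        intervalIntegral.integral_mono_interval hc hcd hd
          (Eventually.of_forall fun x => sq_nonneg _) hg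
      have hnn : 0 ≤ ∫ x in c..d, g x ^ 2 :=
        intervalIntegral.integral_nonneg hcd fun x _ => sq_nonneg _
      set D := f d - f c with hD
      have hDi := h.integral_eq c d (ha.trans_le hc) (ha.trans_le (hc.trans hcd))
      have h1 : ∀ l : ℝ, 0 ≤ (∫ x in c..d, g x ^ 2) - 2 * l * D + l ^ 2 * (d - c) := by
        intro l
        have h2 : 0 ≤ ∫ x in c..d, (g x ^ 2 - 2 * l * g x + l ^ 2) := by
          refine intervalIntegral.integral_nonneg hcd fun x _ => ?_
          nlinarith [sq_nonneg (g x - l)]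
        rw [intervalIntegral.integral_add (hg'.sub (hi.const_mul _)) (by simp),
          intervalIntegral.integral_sub hg' (hi.const_mul _), intervalIntegral.integral_const_mul,
          hDi, intervalIntegral.integral_const, smul_eq_mul] at h2
        linarith
      rcases hcd.eq_or_lt with rfl | hlt
      · have : D = 0 := by simp [hD]
        rw [this]
        have : 0 ≤ (b - a) * ∫ x in a..b, g x ^ 2 :=
          mul_nonneg (by linarith) (hnn.trans hmono)
        simpa using this
      · have h3 := h1 (D / (d - c))
        have hdc : 0 < d - c := by linarith
        have h4 : D ^ 2 ≤ (d - c) * ∫ x in c..d, g x ^ 2 := by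
          have : (∫ x in c..d, g x ^ 2) - 2 * (D / (d - c)) * D + (D / (d - c)) ^ 2 * (d - c) =
              (∫ x in c..d, g x ^ 2) - D ^ 2 / (d - c) := by
            field_simp; ring
          rw [this, sub_nonneg, div_le_iff₀ hdc] at h3
          linarith
        refine h4.trans (mul_le_mul (by linarith) hmono hnn (by linarith))
    intro x hx
    rcases le_total s x with hsx | hsx
    · have := hcs s x hs.1 hsx hx.2
      rwa [hfs, sub_zero] at this
    · have := hcs x s hx.1 hsx hs.2
      rwa [hfs, zero_sub, neg_sq] at this
  have hf := h.continuousOn_uIcc ha hb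
  calc ∫ x in a..b, f x ^ 2 ≤ ∫ x in a..b, ((b - a) * ∫ x in a..b, g x ^ 2) :=
        intervalIntegral.integral_mono_on hab
          (ContinuousOn.intervalIntegrable (by fun_prop)) (by simp) key
    _ = (b - a) ^ 2 * ∫ x in a..b, g x ^ 2 := by
        rw [intervalIntegral.integral_const, smul_eq_mul]; ring

end IsPrimitive

/-! ### Potentials with an inverse square singularity -/

/-- A continuous nonnegative potential on `(0, ∞)` with at most an inverse square singularity of
strength `c` at `0`. -/
structure IsHardyPotential (V : ℝ → ℝ) (c : ℝ) : Prop where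
  continuousOn : ContinuousOn V (Set.Ioi 0)
  nonneg : ∀ r, 0 < r → 0 ≤ V r
  eventually_le : ∀ᶠ r : ℝ in 𝓝[>] 0, r ^ 2 * V r ≤ c

namespace IsHardyPotential

variable {V : ℝ → ℝ} {c : ℝ}

lemma exists_le_near (hV : IsHardyPotential V c) {R : ℝ} (hR : 0 < R) :
    ∃ a, 0 < a ∧ a < R ∧ ∀ r, 0 < r → r ≤ a → r ^ 2 * V r ≤ c := by
  obtain ⟨b, hb, hb'⟩ := mem_nhdsGT_iff_exists_Ioc_subset.1 hV.eventually_le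
  have hb0 : (0 : ℝ) < b := hb
  refine ⟨min b (R / 2), by positivity, (min_le_right _ _).trans_lt (by linarith), ?_⟩
  intro r hr hra
  exact hb' ⟨hr, hra.trans (min_le_left _ _)⟩

lemma exists_le_away (hV : IsHardyPotential V c) {a : ℝ} (ha : 0 < a) (R : ℝ) :
    ∃ M, 0 ≤ M ∧ ∀ r ∈ Set.Icc a R, V r ≤ M := by
  obtain ⟨M, hM⟩ := isCompact_Icc.bddAbove_image
    (hV.continuousOn.mono fun x (hx : x ∈ Set.Icc a R) => ha.trans_le hx.1)
  exact ⟨max M 0, le_max_right _ _, fun r hr =>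
    (hM (Set.mem_image_of_mem _ hr)).trans (le_max_left _ _)⟩

lemma exists_sq_mul_le (hV : IsHardyPotential V c) {R : ℝ} (hR : 0 < R) :
    ∃ M, ∀ r, 0 < r → r ≤ R → r ^ 2 * V r ≤ M := by
  obtain ⟨a, ha, haR, h1⟩ := hV.exists_le_near hR
  obtain ⟨M, hM, h2⟩ := hV.exists_le_away ha R
  refine ⟨max c (R ^ 2 * M), fun r hr hrR => ?_⟩
  rcases le_total r a with hra | hra
  · exact (h1 r hr hra).trans (le_max_left _ _)
  · refine le_trans ?_ (le_max_right _ _)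
    have := h2 r ⟨hra, hrR⟩
    have := hV.nonneg r hr
    gcongr

variable {f g : ℝ → ℝ}

lemma integrableOn_mul_sq (hV : IsHardyPotential V c) (h : IsPrimitive f g) (n : ℕ) {R : ℝ}
    (hR : 0 < R) (hg : IntegrableOn (fun x => x ^ (n + 2) * g x ^ 2) (Set.Ioc 0 R)) :
    IntegrableOn (fun x => x ^ (n + 2) * (V x * f x ^ 2)) (Set.Ioc 0 R) := by
  obtain ⟨M, hM⟩ := hV.exists_sq_mul_le hR
  refine Integrable.mono' ((h.integrableOn_pow_mul_sq n hR hg).const_mul M) ?_ ?_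
  · refine ContinuousOn.aestronglyMeasurable ?_ measurableSet_Ioc
    have h1 := h.continuousOn.mono fun x (hx : x ∈ Set.Ioc 0 R) => hx.1
    have h2 := hV.continuousOn.mono fun x (hx : x ∈ Set.Ioc 0 R) => hx.1
    fun_prop
  · filter_upwards [ae_restrict_mem measurableSet_Ioc] with x hx
    have hx0 : 0 ≤ x := hx.1.le
    have hV0 := hV.nonneg x hx.1
    rw [Real.norm_eq_abs, abs_of_nonneg (by positivity)]
    have h1 := mul_le_mul_of_nonneg_right (hM x hx.1 hx.2)
      (show 0 ≤ x ^ n * f x ^ 2 by positivity)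
    calc x ^ (n + 2) * (V x * f x ^ 2) = x ^ 2 * V x * (x ^ n * f x ^ 2) := by ring
      _ ≤ _ := h1

/-- On a shell away from the origin on which `f` has a zero, the potential energy is dominated by
the kinetic energy, with a constant quadratic in the width of the shell. -/
lemma integral_shell_le (hV : IsHardyPotential V c) (h : IsPrimitive f g) (n : ℕ)
    {a R M α β s : ℝ} (ha : 0 < a) (hM : 0 ≤ M) (hVM : ∀ r ∈ Set.Icc a R, V r ≤ M)
    (hα : a ≤ α) (hβ : β ≤ R) (hs : s ∈ Set.Icc α β) (hfs : f s = 0)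
    (hg : IntervalIntegrable (fun x => x ^ (n + 2) * g x ^ 2) volume α β) :
    ∫ x in α..β, x ^ (n + 2) * (V x * f x ^ 2) ≤
      M * (R / a) ^ (n + 2) * (β - α) ^ 2 * ∫ x in α..β, x ^ (n + 2) * g x ^ 2 := by
  have hαβ : α ≤ β := hs.1.trans hs.2
  have hα0 : 0 < α := ha.trans_le hα
  have hβ0 : 0 < β := hα0.trans_le hαβ
  have hR0 : 0 < R := hβ0.trans_le hβ
  have hf := h.continuousOn_uIcc hα0 hβ0
  have hpos : ∀ x ∈ Set.uIcc α β, 0 < x := fun x hx => (lt_min hα0 hβ0).trans_le hx.1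
  have hVc : ContinuousOn V (Set.uIcc α β) := hV.continuousOn.mono hpos
  have hg2 : IntervalIntegrable (fun x => g x ^ 2) volume α β := by
    have h1 := hg.mul_continuousOn (g := fun x : ℝ => (x ^ (n + 2))⁻¹)
      (ContinuousOn.inv₀ (by fun_prop) fun x hx => pow_ne_zero _ (hpos x hx).ne')
    refine h1.congr fun x hx => ?_
    have : x ^ (n + 2) ≠ 0 := pow_ne_zero _ (hpos x (Set.uIoc_subset_uIcc hx)).ne'
    field_simp
  have h1 : ∫ x in α..β, x ^ (n + 2) * (V x * f x ^ 2) ≤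
      ∫ x in α..β, R ^ (n + 2) * M * f x ^ 2 := by
    refine intervalIntegral.integral_mono_on hαβ (ContinuousOn.intervalIntegrable (by fun_prop))
      (ContinuousOn.intervalIntegrable (by fun_prop)) fun x hx => ?_
    have hx0 : 0 < x := hα0.trans_le hx.1
    have h2 := hVM x ⟨hα.trans hx.1, hx.2.trans hβ⟩
    have h3 := hV.nonneg x hx0
    have h4 : x ≤ R := hx.2.trans hβ
    calc x ^ (n + 2) * (V x * f x ^ 2) ≤ R ^ (n + 2) * (M * f x ^ 2) := by gcongr
      _ = _ := by ring
  have h2 := h.poincare hα0 hs hfs hg2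
  have h3 : ∫ x in α..β, g x ^ 2 ≤ (a ^ (n + 2))⁻¹ * ∫ x in α..β, x ^ (n + 2) * g x ^ 2 := by
    rw [← intervalIntegral.integral_const_mul]
    refine intervalIntegral.integral_mono_on hαβ hg2 (hg.const_mul _) fun x hx => ?_
    rw [inv_mul_eq_div, le_div_iff₀ (by positivity), mul_comm]
    have : a ≤ x := hα.trans hx.1
    gcongr
  rw [intervalIntegral.integral_const_mul] at h1
  calc _ ≤ R ^ (n + 2) * M * ∫ x in α..β, f x ^ 2 := h1
    _ ≤ R ^ (n + 2) * M * ((β - α) ^ 2 * ((a ^ (n + 2))⁻¹ *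
          ∫ x in α..β, x ^ (n + 2) * g x ^ 2)) := by
        gcongr
        exact h2.trans (by gcongr)
    _ = _ := by rw [div_pow]; field_simp

/-- If the inverse square singularity is weaker than Hardy's constant, then the potential energy is
dominated by the kinetic energy as soon as `f` has a zero in each of sufficiently many shells: a
fraction `c / κ²` of the kinetic energy is used near the origin, the rest on the shells. -/
lemma integral_le_of_zeros (hV : IsHardyPotential V c) (h : IsPrimitive f g) (n : ℕ)
    {a R M : ℝ} {k : ℕ} (hk : 0 < k) (ha : 0 < a) (haR : a < R) (hM : 0 ≤ M)
    (hVa : ∀ r, 0 < r → r ≤ a → r ^ 2 * V r ≤ c) (hVM : ∀ r ∈ Set.Icc a R, V r ≤ M)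
    (hsmall : M * (R / a) ^ (n + 2) * ((R - a) / k) ^ 2 ≤ 1 - c / (((n : ℝ) + 1) / 2) ^ 2)
    (hz : ∀ j < k, ∃ s ∈ Set.Icc (a + j * ((R - a) / k)) (a + (j + 1 : ℕ) * ((R - a) / k)),
      f s = 0)
    (hg : IntegrableOn (fun x => x ^ (n + 2) * g x ^ 2) (Set.Ioc 0 R)) :
    ∫ x in 0..R, x ^ (n + 2) * (V x * f x ^ 2) ≤ ∫ x in 0..R, x ^ (n + 2) * g x ^ 2 := by
  have hR : 0 < R := ha.trans haR
  have hk0 : (0 : ℝ) < k := by exact_mod_cast hk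
  set d := (R - a) / k with hd
  have hd0 : 0 < d := div_pos (by linarith) hk0
  have hkd : (k : ℝ) * d = R - a := by rw [hd]; field_simp
  set q : ℕ → ℝ := fun j => a + j * d with hq
  have hq0 : q 0 = a := by simp [hq]
  have hqk : q k = R := by simp only [hq, hkd]; ring
  have hqmono : Monotone q := fun i j hij => by
    have : (i : ℝ) ≤ j := by exact_mod_cast hij
    simp only [hq]
    nlinarith
  have hc : 0 ≤ c := le_trans (mul_nonneg (sq_nonneg _) (hV.nonneg a ha)) (hVa a ha le_rfl)
  set K : ℝ := (((n : ℝ) + 1) / 2) ^ 2 with hK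
  have hK0 : 0 < K := by positivity
  have hPV := hV.integrableOn_mul_sq h n hR hg
  have hF := h.integrableOn_pow_mul_sq n hR hg
  have hsub : ∀ {F : ℝ → ℝ} {α β : ℝ}, IntegrableOn F (Set.Ioc 0 R) → 0 ≤ α → α ≤ β → β ≤ R →
      IntervalIntegrable F volume α β := fun hFi hα hαβ hβ =>
    (intervalIntegrable_iff_integrableOn_Ioc_of_le hαβ).2 (hFi.mono_set (Set.Ioc_subset_Ioc hα hβ))
  set E := ∫ x in 0..R, x ^ (n + 2) * g x ^ 2 with hE
  have hEmono : ∀ α β : ℝ, 0 ≤ α → α ≤ β → β ≤ R → ∫ x in α..β, x ^ (n + 2) * g x ^ 2 ≤ E := by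
    intro α β h1 h2 h3
    refine intervalIntegral.integral_mono_interval h1 h2 h3 ?_ (hsub hg le_rfl hR.le le_rfl)
    filter_upwards [ae_restrict_mem measurableSet_Ioc] with x hx
    have : 0 ≤ x := hx.1.le
    simp only [Pi.zero_apply]
    positivity
  -- near the origin
  have hnear : ∫ x in 0..a, x ^ (n + 2) * (V x * f x ^ 2) ≤ c / K * E := by
    obtain ⟨s, hs, hfs⟩ := hz 0 hk
    have hs1 : a ≤ s := by simpa using hs.1
    have hs2 : s ≤ R := by
      have h1 := hs.2
      have h2 := hqmono (show 0 + 1 ≤ k from hk)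
      simp only [hqk] at h2
      exact h1.trans h2
    have hs0 : 0 < s := ha.trans_le hs1
    have h1 := h.hardy n hs0 hfs (hg.mono_set (Set.Ioc_subset_Ioc_right hs2))
    have h2 : ∫ x in 0..a, x ^ (n + 2) * (V x * f x ^ 2) ≤ ∫ x in 0..a, c * (x ^ n * f x ^ 2) := by
      refine intervalIntegral.integral_mono_on_of_le_Ioo ha.le (hsub hPV le_rfl ha.le haR.le)
        ((hsub hF le_rfl ha.le haR.le).const_mul _) fun x hx => ?_
      have hx0 : 0 < x := hx.1
      have h3 := mul_le_mul_of_nonneg_right (hVa x hx.1 hx.2.le)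
        (show 0 ≤ x ^ n * f x ^ 2 by positivity)
      calc x ^ (n + 2) * (V x * f x ^ 2) = x ^ 2 * V x * (x ^ n * f x ^ 2) := by ring
        _ ≤ _ := h3
    rw [intervalIntegral.integral_const_mul] at h2
    have h3 : ∫ x in 0..a, x ^ n * f x ^ 2 ≤ ∫ x in 0..s, x ^ n * f x ^ 2 := by
      refine intervalIntegral.integral_mono_interval le_rfl ha.le hs1 ?_
        (hsub hF le_rfl hs0.le hs2)
      filter_upwards [ae_restrict_mem measurableSet_Ioc] with x hx
      have : 0 ≤ x := hx.1.le
      simp only [Pi.zero_apply]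
      positivity
    have h4 : ∫ x in 0..s, x ^ n * f x ^ 2 ≤ E / K := by
      rw [le_div_iff₀ hK0, mul_comm]
      exact h1.trans (hEmono 0 s le_rfl hs0.le hs2)
    calc _ ≤ c * ∫ x in 0..a, x ^ n * f x ^ 2 := h2
      _ ≤ c * (E / K) := by gcongr; exact h3.trans h4
      _ = c / K * E := by ring
  -- on the shells
  have hqR : ∀ j < k, a ≤ q j ∧ q j ≤ q (j + 1) ∧ q (j + 1) ≤ R := fun j hj =>
    ⟨by rw [← hq0]; exact hqmono (Nat.zero_le _), hqmono (Nat.le_succ _), by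
      rw [← hqk]; exact hqmono hj⟩
  have hfar : ∫ x in a..R, x ^ (n + 2) * (V x * f x ^ 2) ≤ (1 - c / K) * E := by
    have h1 := intervalIntegral.sum_integral_adjacent_intervals (a := q) (n := k) (μ := volume)
      (f := fun x => x ^ (n + 2) * (V x * f x ^ 2)) fun j hj =>
        hsub hPV (ha.le.trans (hqR j hj).1) (hqR j hj).2.1 (hqR j hj).2.2
    have h2 := intervalIntegral.sum_integral_adjacent_intervals (a := q) (n := k) (μ := volume)
      (f := fun x => x ^ (n + 2) * g x ^ 2) fun j hj =>
        hsub hg (ha.le.trans (hqR j hj).1) (hqR j hj).2.1 (hqR j hj).2.2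
    rw [hq0, hqk] at h1 h2
    have h3 : ∀ j ∈ Finset.range k, ∫ x in (q j)..(q (j + 1)), x ^ (n + 2) * (V x * f x ^ 2) ≤
        M * (R / a) ^ (n + 2) * d ^ 2 * ∫ x in (q j)..(q (j + 1)), x ^ (n + 2) * g x ^ 2 := by
      intro j hj
      have hj' := Finset.mem_range.1 hj
      obtain ⟨s, hs, hfs⟩ := hz j hj'
      have h4 := hV.integral_shell_le h n ha hM hVM (hqR j hj').1 (hqR j hj').2.2 hs hfs
        (hsub hg (ha.le.trans (hqR j hj').1) (hqR j hj').2.1 (hqR j hj').2.2)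
      have h5 : q (j + 1) - q j = d := by simp only [hq]; push_cast; ring
      rwa [h5] at h4
    have h6 := Finset.sum_le_sum h3
    rw [← Finset.mul_sum, h1, h2] at h6
    have h7 : 0 ≤ ∫ x in a..R, x ^ (n + 2) * g x ^ 2 :=
      intervalIntegral.integral_nonneg haR.le fun x hx => by
        have : 0 ≤ x := ha.le.trans hx.1
        positivity
    have h8 := hEmono a R ha.le haR.le le_rfl
    have h9 : 0 ≤ 1 - c / K := le_trans (by positivity) hsmall
    calc _ ≤ _ := h6
      _ ≤ (1 - c / K) * ∫ x in a..R, x ^ (n + 2) * g x ^ 2 := by gcongr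
      _ ≤ _ := by gcongr
  rw [← intervalIntegral.integral_add_adjacent_intervals (hsub hPV le_rfl ha.le haR.le)
    (hsub hPV ha.le haR.le le_rfl)]
  linarith

end IsHardyPotential

lemma exists_zero_of_integral_pow_mul_eq_zero {f : ℝ → ℝ} (hf : ContinuousOn f (Set.Ioi 0))
    (n : ℕ) {a b : ℝ} (ha : 0 < a) (hab : a < b)
    (h : ∫ x in a..b, x ^ n * f x = 0) : ∃ s ∈ Set.Icc a b, f s = 0 := by
  have hfc : ContinuousOn f (Set.Icc a b) := hf.mono fun x hx => ha.trans_le hx.1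
  have hfc' : ContinuousOn f (Set.uIcc a b) := by rwa [Set.uIcc_of_le hab.le]
  have hi : IntervalIntegrable (fun x => x ^ n * f x) volume a b :=
    ContinuousOn.intervalIntegrable (by fun_prop)
  by_contra! hne
  have hsign : (∀ x ∈ Set.Icc a b, 0 < f x) ∨ (∀ x ∈ Set.Icc a b, f x < 0) := by
    by_contra! h'
    obtain ⟨⟨x, hx, hx'⟩, ⟨y, hy, hy'⟩⟩ := h'
    obtain ⟨s, hs, hs'⟩ := isPreconnected_Icc.intermediate_value hx hy hfc ⟨hx', hy'⟩
    exact hne s hs hs'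
  rcases hsign with h1 | h1
  · have := intervalIntegral.intervalIntegral_pos_of_pos_on hi (fun x hx =>
      mul_pos (pow_pos (ha.trans hx.1) n) (h1 x (Set.Ioo_subset_Icc_self hx))) hab
    linarith
  · have := intervalIntegral.intervalIntegral_pos_of_pos_on hi.neg (fun x hx => by
      have := mul_pos (pow_pos (ha.trans hx.1) n) (neg_pos.2 (h1 x (Set.Ioo_subset_Icc_self hx)))
      simp only [Pi.neg_apply]
      linarith) hab
    simp only [Pi.neg_apply] at this
    rw [intervalIntegral.integral_neg, h] at this
    simp at this

/-! ### The linearized potential and the Joseph-Lundgren exponent -/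

/-- The linearized potential `p U^{p-1}`. -/
def potential (p : ℝ) (U : ℝ → ℝ) (r : ℝ) : ℝ := p * U r ^ (p - 1)

/-- The limit of `r² p U(r)^{p-1}` as `r → 0`, that is `p θ (N - 2 - θ)`, simplified by
`p θ = θ + 2`. -/
def hardyStrength (N : ℕ) (p : ℝ) : ℝ := (theta p + 2) * ((N : ℝ) - 2 - theta p)

lemma one_lt_of_pCrit_lt {N : ℕ} (hN : 3 ≤ N) {p : ℝ} (hp : pCrit N < p) : 1 < p := by
  have hN' : (3 : ℝ) ≤ N := by exact_mod_cast hN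
  refine lt_trans ?_ hp
  rw [pCrit, lt_div_iff₀ (by linarith)]
  linarith

lemma theta_pos {p : ℝ} (hp : 1 < p) : 0 < theta p := div_pos two_pos (by linarith)

lemma theta_lt_of_pCrit_lt {N : ℕ} (hN : 3 ≤ N) {p : ℝ} (hp : pCrit N < p) :
    theta p < ((N : ℝ) - 2) / 2 := by
  have hN' : (3 : ℝ) ≤ N := by exact_mod_cast hN
  have hp1 := one_lt_of_pCrit_lt hN hp
  rw [pCrit, div_lt_iff₀ (by linarith)] at hp
  rw [theta, div_lt_div_iff₀ (by linarith) two_pos]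
  nlinarith

/-- The defect from Hardy's constant factors through the two roots `((N - 4) ± 2 √(N - 1)) / 2`. -/
lemma hardyStrength_sub {N : ℕ} (hN : 3 ≤ N) (p : ℝ) :
    hardyStrength N p - (((N : ℝ) - 2) / 2) ^ 2 =
      (theta p - ((N : ℝ) - 4 - 2 * √((N : ℝ) - 1)) / 2) *
        (((N : ℝ) - 4 + 2 * √((N : ℝ) - 1)) / 2 - theta p) := by
  have hN' : (3 : ℝ) ≤ N := by exact_mod_cast hN
  have h := Real.sq_sqrt (show (0 : ℝ) ≤ (N : ℝ) - 1 by linarith)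
  rw [hardyStrength]
  nlinarith

lemma upper_root_factor_pos {N : ℕ} (hN : 3 ≤ N) {p : ℝ} (hp : pCrit N < p) :
    0 < ((N : ℝ) - 4 + 2 * √((N : ℝ) - 1)) / 2 - theta p := by
  have hN' : (3 : ℝ) ≤ N := by exact_mod_cast hN
  have h := theta_lt_of_pCrit_lt hN hp
  have h2 : 1 < √((N : ℝ) - 1) := by
    rw [Real.lt_sqrt zero_le_one]
    linarith
  linarith

lemma lower_root_pos {N : ℕ} (hN : 11 ≤ N) : 0 < (N : ℝ) - 4 - 2 * √((N : ℝ) - 1) := by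
  have hN' : (11 : ℝ) ≤ N := by exact_mod_cast hN
  have h : √((N : ℝ) - 1) < ((N : ℝ) - 4) / 2 := by
    rw [Real.sqrt_lt' (by linarith)]
    nlinarith
  linarith

lemma lower_root_nonpos {N : ℕ} (hN : 3 ≤ N) (hN' : N < 11) :
    (N : ℝ) - 4 - 2 * √((N : ℝ) - 1) ≤ 0 := by
  have h3 : (3 : ℝ) ≤ N := by exact_mod_cast hN
  have h10 : (N : ℝ) ≤ 10 := by exact_mod_cast (by omega : N ≤ 10)
  have h : ((N : ℝ) - 4) / 2 ≤ √((N : ℝ) - 1) := by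
    apply Real.le_sqrt_of_sq_le
    nlinarith
  linarith

lemma hardyStrength_lt_of_pJL_lt {N : ℕ} (hN : 3 ≤ N) {p : ℝ} (hp : pCrit N < p)
    (h : pJL N < (p : EReal)) : hardyStrength N p < (((N : ℝ) - 2) / 2) ^ 2 := by
  have hp1 := one_lt_of_pCrit_lt hN hp
  by_cases h11 : 11 ≤ N
  · rw [pJL, if_pos h11, EReal.coe_lt_coe_iff] at h
    have hl := lower_root_pos h11
    have h1 : theta p < ((N : ℝ) - 4 - 2 * √((N : ℝ) - 1)) / 2 := by
      have h2 : 4 / ((N : ℝ) - 4 - 2 * √((N : ℝ) - 1)) < p - 1 := by linarith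
      rw [div_lt_iff₀ hl] at h2
      rw [theta, div_lt_div_iff₀ (by linarith) two_pos]
      linarith
    have h2 := hardyStrength_sub hN p
    have h3 := mul_neg_of_neg_of_pos (sub_neg.2 h1) (upper_root_factor_pos hN hp)
    linarith
  · rw [pJL, if_neg h11] at h
    exact absurd h not_top_lt

lemma lt_hardyStrength_of_lt_pJL {N : ℕ} (hN : 3 ≤ N) {p : ℝ} (hp : pCrit N < p)
    (h : (p : EReal) < pJL N) : (((N : ℝ) - 2) / 2) ^ 2 < hardyStrength N p := by
  have hp1 := one_lt_of_pCrit_lt hN hp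
  have h1 : ((N : ℝ) - 4 - 2 * √((N : ℝ) - 1)) / 2 < theta p := by
    by_cases h11 : 11 ≤ N
    · rw [pJL, if_pos h11, EReal.coe_lt_coe_iff] at h
      have hl := lower_root_pos h11
      have h2 : p - 1 < 4 / ((N : ℝ) - 4 - 2 * √((N : ℝ) - 1)) := by linarith
      rw [lt_div_iff₀ hl] at h2
      rw [theta, div_lt_div_iff₀ two_pos (by linarith)]
      linarith
    · have h2 := lower_root_nonpos hN (by omega)
      linarith [theta_pos hp1]
  have h2 := hardyStrength_sub hN p
  have h3 := mul_pos (sub_pos.2 h1) (upper_root_factor_pos hN hp)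
  linarith

namespace IsSingularSolution

variable {N : ℕ} {p : ℝ} {U : ℝ → ℝ}

lemma continuousOn_potential (hU : IsSingularSolution N p U) :
    ContinuousOn (potential p U) (Set.Ioi 0) :=
  continuousOn_const.mul
    (hU.contDiffOn.continuousOn.rpow_const fun r hr => Or.inl (hU.pos r hr).ne')

lemma potential_nonneg (hU : IsSingularSolution N p U) (hp : 1 < p) {r : ℝ} (hr : 0 < r) :
    0 ≤ potential p U r :=
  mul_nonneg (by linarith) (Real.rpow_nonneg (hU.pos r hr).le _)

lemma tendsto_sq_mul_potential (hN : 3 ≤ N) (hp : pCrit N < p) (hU : IsSingularSolution N p U) :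
    Tendsto (fun r => r ^ 2 * potential p U r) (𝓝[>] 0) (𝓝 (hardyStrength N p)) := by
  have hN' : (3 : ℝ) ≤ N := by exact_mod_cast hN
  have hp1 := one_lt_of_pCrit_lt hN hp
  have hp0 : p - 1 ≠ 0 := by linarith
  have hθ := theta_pos hp1
  have hθ' := theta_lt_of_pCrit_lt hN hp
  have hA : 0 < theta p * ((N : ℝ) - 2 - theta p) := mul_pos hθ (by linarith)
  have h1 : Tendsto (fun r : ℝ => p * (r ^ theta p * U r) ^ (p - 1)) (𝓝[>] 0)
      (𝓝 (p * singAmplitude N p ^ (p - 1))) :=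
    (hU.tendsto_zero.rpow_const (Or.inr (by linarith))).const_mul p
  have h2 : p * singAmplitude N p ^ (p - 1) = hardyStrength N p := by
    rw [singAmplitude, ← Real.rpow_mul hA.le, one_div, inv_mul_cancel₀ hp0, Real.rpow_one,
      hardyStrength]
    have : p * theta p = theta p + 2 := by rw [theta]; field_simp; ring
    rw [← mul_assoc, this]
  rw [← h2]
  refine h1.congr' ?_
  filter_upwards [self_mem_nhdsWithin] with r hr
  have hr0 : (0 : ℝ) < r := hr
  have h3 : theta p * (p - 1) = 2 := by rw [theta]; field_simp
  rw [Real.mul_rpow (Real.rpow_nonneg hr0.le _) (hU.pos r hr0).le, ← Real.rpow_mul hr0.le, h3,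
    Real.rpow_two, potential]
  ring

lemma isHardyPotential (hN : 3 ≤ N) (hp : pCrit N < p) (hU : IsSingularSolution N p U) {c : ℝ}
    (hc : hardyStrength N p < c) : IsHardyPotential (potential p U) c :=
  ⟨hU.continuousOn_potential, fun _ hr => hU.potential_nonneg (one_lt_of_pCrit_lt hN hp) hr,
    ((tendsto_sq_mul_potential hN hp hU).eventually (Iic_mem_nhds hc)).mono fun _ h => h⟩

end IsSingularSolution

/-! ### The bilinear form and its negative eigenspaces -/

/-- The pairs `(u, G)` whose potential energy `∫ V u²` is finite, expressed by `√V u ∈ L²`. -/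
def formDomain (N : ℕ) (R : ℝ) (V : ℝ → ℝ) : Submodule ℝ (L2Pair N R) where
  carrier := {w | MemLp (fun x => √(V ‖x‖) * w.1 x) 2 (ballMeasure N R)}
  zero_mem' := by
    refine (MemLp.zero (ε := ℝ)).ae_eq ?_
    filter_upwards [Lp.coeFn_zero ℝ 2 (ballMeasure N R)] with x hx
    rw [Prod.fst_zero, hx]
    simp
  add_mem' := by
    intro w z hw hz
    refine (MemLp.add hw hz).ae_eq ?_
    filter_upwards [Lp.coeFn_add w.1 z.1] with x hx
    rw [Prod.fst_add, hx]
    simp only [Pi.add_apply]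
    ring
  smul_mem' := by
    intro k w hw
    refine (MemLp.const_mul hw k).ae_eq ?_
    filter_upwards [Lp.coeFn_smul k w.1] with x hx
    rw [Prod.smul_fst, hx]
    simp only [Pi.smul_apply, smul_eq_mul]
    ring

section Form

variable {N : ℕ} {R p : ℝ} {U : ℝ → ℝ}

lemma ae_ball_norm_pos (hN : 1 ≤ N) : ∀ᵐ x ∂(ballMeasure N R), 0 < ‖x‖ :=
  ae_ball_of_ae_Ioo (P := fun r => 0 < r) hN (Eventually.of_forall fun _ hr => hr.1)

lemma integrable_potential_mul (hN : 1 ≤ N) (hV : ∀ r, 0 < r → 0 ≤ potential p U r)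
    {w z : L2Pair N R} (hw : w ∈ formDomain N R (potential p U))
    (hz : z ∈ formDomain N R (potential p U)) :
    Integrable (fun x => potential p U ‖x‖ * (w.1 x * z.1 x)) (ballMeasure N R) := by
  refine (MemLp.integrable_mul hw hz).congr ?_
  filter_upwards [ae_ball_norm_pos hN] with x hx
  have := Real.sq_sqrt (hV _ hx)
  simp only [Pi.mul_apply]
  linear_combination (w.1 x * z.1 x) * this

lemma integrable_fst_mul (w z : L2Pair N R) :
    Integrable (fun x => w.1 x * z.1 x) (ballMeasure N R) :=
  (Lp.memLp w.1).integrable_mul (Lp.memLp z.1)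

lemma integrable_inner_snd (w z : L2Pair N R) :
    Integrable (fun x => inner ℝ (w.2 x) (z.2 x)) (ballMeasure N R) :=
  L2.integrable_inner w.2 z.2

lemma integrable_linForm (hN : 1 ≤ N) (hV : ∀ r, 0 < r → 0 ≤ potential p U r)
    {w z : L2Pair N R} (hw : w ∈ formDomain N R (potential p U))
    (hz : z ∈ formDomain N R (potential p U)) :
    Integrable (fun x => inner ℝ (w.2 x) (z.2 x) + w.1 x * z.1 x -
      p * U ‖x‖ ^ (p - 1) * (w.1 x * z.1 x)) (ballMeasure N R) :=
  ((integrable_inner_snd w z).add (integrable_fst_mul w z)).sub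
    (integrable_potential_mul hN hV hw hz)

lemma linForm_comm (w z : L2Pair N R) : linForm p U w z = linForm p U z w := by
  unfold linForm
  congr 1 with x
  rw [real_inner_comm]
  ring

lemma linForm_add_left (hN : 1 ≤ N) (hV : ∀ r, 0 < r → 0 ≤ potential p U r)
    {w w' z : L2Pair N R} (hw : w ∈ formDomain N R (potential p U))
    (hw' : w' ∈ formDomain N R (potential p U)) (hz : z ∈ formDomain N R (potential p U)) :
    linForm p U (w + w') z = linForm p U w z + linForm p U w' z := by
  unfold linForm
  rw [← integral_add (integrable_linForm hN hV hw hz) (integrable_linForm hN hV hw' hz)]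
  apply integral_congr_ae
  filter_upwards [Lp.coeFn_add w.1 w'.1, Lp.coeFn_add w.2 w'.2] with x h1 h2
  rw [Prod.fst_add, Prod.snd_add, h1, h2]
  simp only [Pi.add_apply, inner_add_left]
  ring

lemma linForm_smul_left (k : ℝ) (w z : L2Pair N R) :
    linForm p U (k • w) z = k * linForm p U w z := by
  unfold linForm
  rw [← integral_const_mul]
  apply integral_congr_ae
  filter_upwards [Lp.coeFn_smul k w.1, Lp.coeFn_smul k w.2] with x h1 h2
  rw [Prod.smul_fst, Prod.smul_snd, h1, h2]
  simp only [Pi.smul_apply, smul_eq_mul, real_inner_smul_left]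
  ring

/-- The form `linForm`, bilinear on the pairs of finite potential energy. -/
def linFormBilin (hN : 1 ≤ N) (hV : ∀ r, 0 < r → 0 ≤ potential p U r) :
    LinearMap.BilinForm ℝ (formDomain N R (potential p U)) :=
  LinearMap.mk₂ ℝ (fun w z => linForm p U w.1 z.1)
    (fun w w' z => linForm_add_left hN hV w.2 w'.2 z.2)
    (fun k w z => linForm_smul_left k w.1 z.1)
    (fun w z z' => by
      simp only [linForm_comm w.1]
      exact linForm_add_left hN hV z.2 z'.2 w.2)
    (fun k w z => by
      simp only [linForm_comm w.1]
      exact linForm_smul_left k z.1 w.1)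

lemma linForm_sum_sum (hN : 1 ≤ N) (hV : ∀ r, 0 < r → 0 ≤ potential p U r) {ι : Type*}
    (s : Finset ι) {w : ι → L2Pair N R} (hw : ∀ i, w i ∈ formDomain N R (potential p U)) :
    linForm p U (∑ i ∈ s, w i) (∑ i ∈ s, w i) = ∑ i ∈ s, ∑ j ∈ s, linForm p U (w i) (w j) := by
  have h : linFormBilin hN hV (∑ i ∈ s, ⟨w i, hw i⟩) (∑ i ∈ s, ⟨w i, hw i⟩) =
      ∑ i ∈ s, ∑ j ∈ s, linFormBilin hN hV ⟨w i, hw i⟩ ⟨w j, hw j⟩ := by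
    simp only [map_sum, LinearMap.sum_apply]
    exact Finset.sum_comm
  have h1 : linForm p U (∑ i ∈ s, w i) (∑ i ∈ s, w i) =
      linFormBilin hN hV (∑ i ∈ s, ⟨w i, hw i⟩) (∑ i ∈ s, ⟨w i, hw i⟩) := by
    change _ = linForm p U (Subtype.val _) (Subtype.val _)
    rw [Submodule.coe_sum]
  rw [h1, h]
  rfl

/-- The eigenspace of the radial Neumann problem for `α`, a subspace because the potential energy
is finite on `H¹_rad`. -/
def radialEigenspace (hN : 1 ≤ N) (hV : ∀ r, 0 < r → 0 ≤ potential p U r)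
    (hD : H1rad N R ≤ formDomain N R (potential p U)) (α : ℝ) : Submodule ℝ (L2Pair N R) where
  carrier := {w | IsRadialEigenfunction p U α w}
  zero_mem' := by
    refine ⟨zero_mem _, fun z _ => ?_⟩
    have h1 : linForm p U (0 : L2Pair N R) z = 0 := by
      have := linForm_smul_left (p := p) (U := U) 0 0 z
      simpa using this
    have h2 : ∫ x, (0 : L2Pair N R).1 x * z.1 x ∂(ballMeasure N R) = 0 := by
      apply integral_eq_zero_of_ae
      filter_upwards [Lp.coeFn_zero ℝ 2 (ballMeasure N R)] with x hx
      rw [Prod.fst_zero, hx]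
      simp
    rw [h1, h2, mul_zero]
  add_mem' := by
    rintro w w' ⟨hw, h⟩ ⟨hw', h'⟩
    refine ⟨add_mem hw hw', fun z hz => ?_⟩
    rw [linForm_add_left hN hV (hD hw) (hD hw') (hD hz), h z hz, h' z hz, ← mul_add,
      ← integral_add (integrable_fst_mul w z) (integrable_fst_mul w' z)]
    congr 1
    apply integral_congr_ae
    filter_upwards [Lp.coeFn_add w.1 w'.1] with x hx
    rw [Prod.fst_add, hx]
    simp only [Pi.add_apply]
    ring
  smul_mem' := by
    rintro k w ⟨hw, h⟩
    refine ⟨Submodule.smul_mem _ k hw, fun z hz => ?_⟩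
    rw [linForm_smul_left, h z hz, mul_left_comm, ← integral_const_mul]
    congr 1
    apply integral_congr_ae
    filter_upwards [Lp.coeFn_smul k w.1] with x hx
    rw [Prod.smul_fst, hx]
    simp only [Pi.smul_apply, smul_eq_mul]
    ring

/-- The weak gradient is determined by the function. -/
lemma eq_zero_of_fst_eq_zero {w : L2Pair N R} (hw : w ∈ H1rad N R) (h : w.1 = 0) : w = 0 := by
  have hG : ∀ v : EuclideanSpace ℝ (Fin N), ∀ᵐ x ∂(ballMeasure N R), inner ℝ (w.2 x) v = 0 := by
    intro v
    have hi : MemLp (fun x => inner ℝ (w.2 x) v) 2 (ballMeasure N R) :=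
      (Lp.memLp w.2).inner_const v
    have hloc : LocallyIntegrableOn (fun x => inner ℝ (w.2 x) v)
        (Metric.ball (0 : EuclideanSpace ℝ (Fin N)) R) volume :=
      IntegrableOn.locallyIntegrableOn (hi.integrable (by norm_num))
    have := Metric.isOpen_ball.ae_eq_zero_of_integral_contDiff_smul_eq_zero hloc (by
      intro φ h1 h2 h3
      have h4 := hw.2 φ h1 h2 h3 v
      have h5 : ∫ x, w.1 x * fderiv ℝ φ x v ∂(ballMeasure N R) = 0 := by
        apply integral_eq_zero_of_ae
        filter_upwards [Lp.coeFn_zero ℝ 2 (ballMeasure N R)] with x hx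
        rw [h, hx]
        simp
      rw [h5, zero_eq_neg] at h4
      rw [← h4, ← setIntegral_eq_integral_of_forall_compl_eq_zero
        (s := Metric.ball (0 : EuclideanSpace ℝ (Fin N)) R)]
      · congr 1 with x
        rw [smul_eq_mul, mul_comm]
      · intro x hx
        have : φ x = 0 := by
          by_contra hne
          exact hx (h3 (subset_tsupport _ hne))
        rw [this, zero_smul])
    rw [ae_restrict_iff' Metric.isOpen_ball.measurableSet]
    exact this
  refine Prod.ext h (Lp.ext ?_)
  have hall : ∀ᵐ x ∂(ballMeasure N R), ∀ i : Fin N,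
      inner ℝ (w.2 x) (EuclideanSpace.single i (1 : ℝ)) = 0 := ae_all_iff.2 fun i => hG _
  filter_upwards [hall, Lp.coeFn_zero (EuclideanSpace ℝ (Fin N)) 2 (ballMeasure N R)]
    with x hx h0
  rw [Prod.snd_zero, h0]
  ext i
  have := hx i
  rw [EuclideanSpace.inner_single_right] at this
  simpa using this

/-- If the form is nonnegative on the kernel of a linear map `T` into a finite dimensional space,
then `T` is injective on the sum of the eigenspaces with negative eigenvalues: by orthogonality of
the eigenspaces, the form is `∑ αᵢ ‖uᵢ‖²` on a sum of eigenfunctions. -/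
lemma finiteDimensional_negativeEigenspace (hN : 1 ≤ N)
    (hV : ∀ r, 0 < r → 0 ≤ potential p U r)
    (hD : H1rad N R ≤ formDomain N R (potential p U)) {k : ℕ}
    (T : L2Pair N R →ₗ[ℝ] (Fin k → ℝ))
    (hT : ∀ w ∈ H1rad N R, T w = 0 → 0 ≤ linForm p U w w) :
    FiniteDimensional ℝ (negativeEigenspace N R p U) := by
  set E := negativeEigenspace N R p U with hE
  have hker : ∀ w ∈ E, T w = 0 → w = 0 := by
    intro w hw hTw
    have hle : E ≤ ⨆ α : {α : ℝ // α < 0}, radialEigenspace hN hV hD α := by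
      rw [hE, negativeEigenspace, Submodule.span_le]
      rintro z ⟨α, hα, hz⟩
      exact Submodule.mem_iSup_of_mem (p := fun α : {α : ℝ // α < 0} =>
        radialEigenspace hN hV hD α) ⟨α, hα⟩ hz
    obtain ⟨v, hv, hvw⟩ := (Submodule.mem_iSup_iff_exists_finsupp _ _).1 (hle hw)
    rw [Finsupp.sum] at hvw
    have hvE : ∀ α : {α : ℝ // α < 0}, IsRadialEigenfunction p U α (v α) := hv
    have hvH : ∀ α, v α ∈ H1rad N R := fun α => (hvE α).1
    have hwH : w ∈ H1rad N R := by
      rw [← hvw]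
      exact Submodule.sum_mem _ fun α _ => hvH α
    set I : {α : ℝ // α < 0} → {α : ℝ // α < 0} → ℝ := fun α β =>
      ∫ x, (v α).1 x * (v β).1 x ∂(ballMeasure N R) with hI
    have hIcomm : ∀ α β, I α β = I β α := fun α β => by
      simp only [hI]
      congr 1 with x
      ring
    have hform : ∀ α β, linForm p U (v α) (v β) = α * I α β := fun α β =>
      (hvE α).2 (v β) (hvH β)
    have horth : ∀ α β, α ≠ β → I α β = 0 := by
      intro α β hne
      have h1 := hform α β
      rw [linForm_comm, hform β α, hIcomm β α] at h1
      have h2 : ((α : ℝ) - β) * I α β = 0 := by linarith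
      rcases mul_eq_zero.1 h2 with h3 | h3
      · exact absurd (Subtype.ext (sub_eq_zero.1 h3)) hne
      · exact h3
    have hJ : linForm p U w w = ∑ α ∈ v.support, (α : ℝ) * I α α := by
      rw [← hvw, linForm_sum_sum hN hV _ fun α => hD (hvH α)]
      refine Finset.sum_congr rfl fun α hα => ?_
      rw [Finset.sum_eq_single α, hform]
      · intro β _ hne
        rw [hform, horth α β hne.symm, mul_zero]
      · exact fun h => absurd hα h
    have hIpos : ∀ α, 0 ≤ I α α := fun α => integral_nonneg fun x => mul_self_nonneg _
    have hterm : ∀ α ∈ v.support, (α : ℝ) * I α α ≤ 0 := fun α _ =>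
      mul_nonpos_of_nonpos_of_nonneg α.2.le (hIpos α)
    have h0 := hT w hwH hTw
    rw [hJ] at h0
    have hzero := (Finset.sum_eq_zero_iff_of_nonpos hterm).1
      (le_antisymm (Finset.sum_nonpos hterm) h0)
    rw [← hvw]
    refine Finset.sum_eq_zero fun α hα => eq_zero_of_fst_eq_zero (hvH α) ?_
    have h1 : I α α = 0 := by
      rcases mul_eq_zero.1 (hzero α hα) with h | h
      · exact absurd h α.2.ne
      · exact h
    have h2 := (integral_eq_zero_iff_of_nonneg (fun x => mul_self_nonneg _)
      (integrable_fst_mul (v α) (v α))).1 h1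
    refine Lp.ext ?_
    filter_upwards [h2, Lp.coeFn_zero ℝ 2 (ballMeasure N R)] with x hx hx0
    rw [hx0]
    simpa using hx
  refine FiniteDimensional.of_injective (T.domRestrict E) ?_
  rw [← LinearMap.ker_eq_bot, LinearMap.ker_eq_bot']
  intro w hw
  exact Subtype.ext (hker w.1 w.2 hw)

lemma radialMorseIndex_le {k : ℕ} (T : L2Pair N R →ₗ[ℝ] (Fin k → ℝ))
    (hT : ∀ w ∈ H1rad N R, T w = 0 → 0 ≤ linForm p U w w) : radialMorseIndex N R p U ≤ k := by
  unfold radialMorseIndex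
  refine iSup₂_le fun V ⟨hVH, _, hneg⟩ => ?_
  have hinj : Function.Injective (T.domRestrict V) := by
    rw [← LinearMap.ker_eq_bot, LinearMap.ker_eq_bot']
    intro w hw
    by_contra hne
    have h1 := hneg w.1 w.2 fun h => hne (Subtype.ext h)
    have h2 := hT w.1 (hVH w.2) hw
    linarith
  have := LinearMap.finrank_le_finrank_of_injective hinj
  rw [Module.finrank_fin_fun] at this
  exact_mod_cast this

end Form

/-! ### Finiteness above the Joseph-Lundgren exponent -/

section Supercritical

variable {N : ℕ} {R p : ℝ} {U : ℝ → ℝ}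

lemma aestronglyMeasurable_radial {N : ℕ} (hN : 1 ≤ N) {R : ℝ} {F : ℝ → ℝ}
    (hF : ContinuousOn F (Set.Ioi 0)) :
    AEStronglyMeasurable (fun x => F ‖x‖) (ballMeasure N R) := by
  have : Nonempty (Fin N) := ⟨⟨0, hN⟩⟩
  have h1 : ContinuousOn (fun x : EuclideanSpace ℝ (Fin N) => F ‖x‖) {0}ᶜ :=
    hF.comp continuous_norm.continuousOn fun x hx => norm_pos_iff.2 hx
  have h2 := h1.aestronglyMeasurable (μ := volume) (measurableSet_singleton _).compl
  rw [restrict_compl_singleton] at h2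
  exact h2.restrict

lemma IsRadialProfile.integrableOn_pow_mul_sq {n : ℕ} {w : L2Pair (n + 3) R} {f g : ℝ → ℝ}
    (h : IsRadialProfile w f g) : IntegrableOn (fun x => x ^ (n + 2) * g x ^ 2) (Set.Ioc 0 R) := by
  have := (integrable_ball_radial (N := n + 3) (by omega) R fun r => g r ^ 2).1 h.integrable_sq
  rw [integrableOn_Ioc_iff_integrableOn_Ioo]
  exact this

lemma IsRadialProfile.integrable_potential {n : ℕ} {w : L2Pair (n + 3) R} {f g V : ℝ → ℝ} {c : ℝ}
    (h : IsRadialProfile w f g) (hV : IsHardyPotential V c) (hR : 0 < R) :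
    Integrable (fun x => V ‖x‖ * f ‖x‖ ^ 2) (ballMeasure (n + 3) R) := by
  have h1 := hV.integrableOn_mul_sq h.isPrimitive n hR h.integrableOn_pow_mul_sq
  rw [integrableOn_Ioc_iff_integrableOn_Ioo] at h1
  exact (integrable_ball_radial (N := n + 3) (by omega) R fun r => V r * f r ^ 2).2 h1

/-- By Hardy's inequality, the potential energy is finite on all of `H¹_rad`. -/
lemma H1rad_le_formDomain (hN : 3 ≤ N) (hR : 0 < R) {V : ℝ → ℝ} {c : ℝ}
    (hV : IsHardyPotential V c) : H1rad N R ≤ formDomain N R V := by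
  obtain ⟨n, rfl⟩ : ∃ n, N = n + 3 := ⟨N - 3, by omega⟩
  intro w hw
  obtain ⟨f, g, h⟩ := exists_isRadialProfile (by omega) hR hw
  have hm : AEStronglyMeasurable (fun x => √(V ‖x‖) * f ‖x‖) (ballMeasure (n + 3) R) :=
    aestronglyMeasurable_radial (by omega) (F := fun r => √(V r) * f r)
      (hV.continuousOn.sqrt.mul h.isPrimitive.continuousOn)
  have h2 : MemLp (fun x => √(V ‖x‖) * f ‖x‖) 2 (ballMeasure (n + 3) R) := by
    rw [memLp_two_iff_integrable_sq hm]
    refine (h.integrable_potential hV hR).congr ?_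
    filter_upwards [ae_ball_norm_pos (by omega)] with x hx
    rw [mul_pow, Real.sq_sqrt (hV.nonneg _ hx)]
  refine h2.ae_eq ?_
  filter_upwards [h.coe_eq] with x hx
  rw [hx]

/-- The integrals of `u` over the shells `q j < |x| ≤ q (j + 1)`. -/
def shellIntegrals (N : ℕ) (R : ℝ) (q : ℕ → ℝ) (k : ℕ) : L2Pair N R →ₗ[ℝ] (Fin k → ℝ) where
  toFun w j := ∫ x in {x | ‖x‖ ∈ Set.Ioc (q j) (q (j + 1))}, w.1 x ∂(ballMeasure N R)
  map_add' w z := by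
    ext j
    have hi : ∀ w : L2Pair N R, Integrable (fun x => w.1 x) (ballMeasure N R) := fun w =>
      (Lp.memLp w.1).integrable (by norm_num)
    simp only [Pi.add_apply]
    rw [← integral_add (hi w).restrict (hi z).restrict]
    apply integral_congr_ae
    filter_upwards [ae_restrict_of_ae (Lp.coeFn_add w.1 z.1)] with x hx
    rw [Prod.fst_add, hx]
    rfl
  map_smul' c w := by
    ext j
    simp only [Pi.smul_apply, smul_eq_mul, RingHom.id_apply]
    rw [← integral_const_mul]
    apply integral_congr_ae
    filter_upwards [ae_restrict_of_ae (Lp.coeFn_smul c w.1)] with x hx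
    rw [Prod.smul_fst, hx]
    rfl

lemma IsRadialProfile.integral_shell {w : L2Pair N R} {f g : ℝ → ℝ} (h : IsRadialProfile w f g)
    (hN : 1 ≤ N) {a b : ℝ} (ha : 0 < a) (hab : a ≤ b) (hb : b ≤ R) :
    ∫ x in {x | ‖x‖ ∈ Set.Ioc a b}, w.1 x ∂(ballMeasure N R) =
      sphereArea N * ∫ r in a..b, r ^ (N - 1) * f r := by
  have hmeas : MeasurableSet {x : EuclideanSpace ℝ (Fin N) | ‖x‖ ∈ Set.Ioc a b} :=
    measurable_norm measurableSet_Ioc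
  rw [← integral_indicator hmeas]
  have h1 : ∫ x, {x | ‖x‖ ∈ Set.Ioc a b}.indicator (fun x => w.1 x) x ∂(ballMeasure N R) =
      ∫ x, (Set.Ioc a b).indicator f ‖x‖ ∂(ballMeasure N R) := by
    apply integral_congr_ae
    filter_upwards [h.coe_eq] with x hx
    by_cases hm : ‖x‖ ∈ Set.Ioc a b
    · rw [Set.indicator_of_mem hm, Set.indicator_of_mem (by exact hm), hx]
    · rw [Set.indicator_of_notMem hm, Set.indicator_of_notMem (by exact hm)]
  rw [h1, integral_ball_radial hN, intervalIntegral.integral_of_le hab,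
    ← integral_Ioc_eq_integral_Ioo]
  congr 1
  have h2 : ∀ r, r ^ (N - 1) * (Set.Ioc a b).indicator f r =
      (Set.Ioc a b).indicator (fun r => r ^ (N - 1) * f r) r := fun r => by
    by_cases hm : r ∈ Set.Ioc a b <;> simp [hm]
  simp_rw [h2]
  rw [setIntegral_indicator measurableSet_Ioc,
    Set.inter_eq_right.2 (Set.Ioc_subset_Ioc ha.le hb)]

lemma linForm_nonneg_of_profile {n : ℕ} (hR : 0 < R) {w : L2Pair (n + 3) R} {f g : ℝ → ℝ} {c : ℝ}
    (h : IsRadialProfile w f g) (hV : IsHardyPotential (potential p U) c)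
    (hle : ∫ x in 0..R, x ^ (n + 2) * (potential p U x * f x ^ 2) ≤
      ∫ x in 0..R, x ^ (n + 2) * g x ^ 2) : 0 ≤ linForm p U w w := by
  have hpot : ∫ x, potential p U ‖x‖ * f ‖x‖ ^ 2 ∂(ballMeasure (n + 3) R) ≤
      ∫ x, g ‖x‖ ^ 2 ∂(ballMeasure (n + 3) R) := by
    rw [intervalIntegral.integral_of_le hR.le, intervalIntegral.integral_of_le hR.le,
      integral_Ioc_eq_integral_Ioo, integral_Ioc_eq_integral_Ioo] at hle
    rw [integral_ball_radial (by omega) R fun r => potential p U r * f r ^ 2,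
      integral_ball_radial (by omega) R fun r => g r ^ 2]
    exact mul_le_mul_of_nonneg_left hle (sphereArea_pos (by omega)).le
  have hkin : Integrable (fun x => ‖w.2 x‖ ^ 2) (ballMeasure (n + 3) R) :=
    (Lp.memLp w.2).integrable_norm_pow (by norm_num)
  have hsq := integrable_fst_mul w w
  have h1 : linForm p U w w = ∫ x, (‖w.2 x‖ ^ 2 + w.1 x * w.1 x -
      potential p U ‖x‖ * f ‖x‖ ^ 2) ∂(ballMeasure (n + 3) R) := by
    unfold linForm
    apply integral_congr_ae
    filter_upwards [h.coe_eq] with x hx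
    rw [real_inner_self_eq_norm_sq, potential, hx]
    ring
  have hsum : Integrable (fun x => ‖w.2 x‖ ^ 2 + w.1 x * w.1 x) (ballMeasure (n + 3) R) :=
    hkin.add hsq
  rw [h1, integral_sub hsum (h.integrable_potential hV hR), integral_add hkin hsq]
  have h2 : 0 ≤ ∫ x, w.1 x * w.1 x ∂(ballMeasure (n + 3) R) :=
    integral_nonneg fun x => mul_self_nonneg _
  linarith [h.energy_le]

/-- Below Hardy's constant, finitely many linear conditions (vanishing means on thin shells) make
the form nonnegative on `H¹_rad`. -/
theorem exists_linearMap_nonneg_on_ker (hN : 3 ≤ N) (hR : 0 < R) {c : ℝ}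
    (hV : IsHardyPotential (potential p U) c) (hc : c < (((N : ℝ) - 2) / 2) ^ 2) :
    ∃ (k : ℕ) (T : L2Pair N R →ₗ[ℝ] (Fin k → ℝ)),
      ∀ w ∈ H1rad N R, T w = 0 → 0 ≤ linForm p U w w := by
  obtain ⟨n, rfl⟩ : ∃ n, N = n + 3 := ⟨N - 3, by omega⟩
  have hκ : (((n + 3 : ℕ) : ℝ) - 2) / 2 = ((n : ℝ) + 1) / 2 := by push_cast; ring
  rw [hκ] at hc
  obtain ⟨a, ha, haR, hVa⟩ := hV.exists_le_near hR
  obtain ⟨M, hM, hVM⟩ := hV.exists_le_away ha R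
  set K : ℝ := (((n : ℝ) + 1) / 2) ^ 2 with hK
  have hK0 : 0 < K := by positivity
  have hε : 0 < 1 - c / K := by
    rw [sub_pos, div_lt_one hK0]
    exact hc
  set B : ℝ := M * (R / a) ^ (n + 2) * (R - a) ^ 2 with hB
  obtain ⟨k, hk⟩ := exists_nat_ge (max 1 (B / (1 - c / K)))
  have hk1 : (1 : ℝ) ≤ k := (le_max_left _ _).trans hk
  have hk0 : 0 < k := by exact_mod_cast (zero_lt_one.trans_le hk1)
  have hkB : B ≤ k * (1 - c / K) := by
    rw [← div_le_iff₀ hε]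
    exact (le_max_right _ _).trans hk
  set q : ℕ → ℝ := fun j => a + j * ((R - a) / k) with hq
  have hd0 : 0 < (R - a) / k := div_pos (by linarith) (by linarith)
  refine ⟨k, shellIntegrals (n + 3) R q k, fun w hw hTw => ?_⟩
  obtain ⟨f, g, h⟩ := exists_isRadialProfile (by omega) hR hw
  refine linForm_nonneg_of_profile hR h hV
    (hV.integral_le_of_zeros h.isPrimitive n hk0 ha haR hM hVa hVM ?_ ?_
      h.integrableOn_pow_mul_sq)
  · have h1 : M * (R / a) ^ (n + 2) * ((R - a) / k) ^ 2 = B / k ^ 2 := by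
      rw [hB]; field_simp
    rw [h1, div_le_iff₀ (by positivity), ← hK]
    calc B ≤ k * (1 - c / K) := hkB
      _ ≤ k ^ 2 * (1 - c / K) := by gcongr; nlinarith
      _ = (1 - c / K) * k ^ 2 := mul_comm _ _
  · intro j hj
    have hqj : a ≤ q j := by
      have : (0 : ℝ) ≤ j * ((R - a) / k) := by positivity
      simp only [hq]
      linarith
    have hqlt : q j < q (j + 1) := by
      simp only [hq]
      push_cast
      linarith
    have hqR : q (j + 1) ≤ R := by
      have h1 : ((j + 1 : ℕ) : ℝ) ≤ k := by exact_mod_cast hj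
      have h2 : ((j + 1 : ℕ) : ℝ) * ((R - a) / k) ≤ k * ((R - a) / k) := by gcongr
      have h3 : (k : ℝ) * ((R - a) / k) = R - a := by field_simp
      simp only [hq]
      linarith
    have h1 : (shellIntegrals (n + 3) R q k w) ⟨j, hj⟩ = 0 := by rw [hTw]; rfl
    have h2 := h.integral_shell (by omega) (ha.trans_le hqj) hqlt.le hqR
    have h3 : ∫ r in (q j)..(q (j + 1)), r ^ (n + 3 - 1) * f r = 0 := by
      have h4 : sphereArea (n + 3) * ∫ r in (q j)..(q (j + 1)), r ^ (n + 3 - 1) * f r = 0 := by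
        rw [← h2]; exact h1
      exact (mul_eq_zero.1 h4).resolve_left (sphereArea_pos (by omega)).ne'
    exact exists_zero_of_integral_pow_mul_eq_zero h.isPrimitive.continuousOn _
      (ha.trans_le hqj) hqlt h3

theorem finite_of_pJL_lt (hN : 3 ≤ N) (hR : 0 < R) (hp : pCrit N < p)
    (hU : IsSingularSolution N p U) (h : pJL N < (p : EReal)) :
    radialMorseIndex N R p U < ⊤ ∧ FiniteDimensional ℝ (negativeEigenspace N R p U) := by
  obtain ⟨c, hc, hc'⟩ := exists_between (hardyStrength_lt_of_pJL_lt hN hp h)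
  have hV := hU.isHardyPotential hN hp hc
  obtain ⟨k, T, hT⟩ := exists_linearMap_nonneg_on_ker hN hR hV hc'
  exact ⟨(radialMorseIndex_le T hT).trans_lt (ENat.natCast_lt_top k),
    finiteDimensional_negativeEigenspace (by omega) hV.nonneg (H1rad_le_formDomain hN hR hV) T hT⟩

end Supercritical

/-! ### Smooth radial functions supported in annuli -/

section RadialPair

variable {N : ℕ} {R a b p : ℝ} {U ζ : ℝ → ℝ}

namespace IsAnnularProfile

lemma gradient_norm (h : IsAnnularProfile ζ a b) (x : EuclideanSpace ℝ (Fin N)) :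
    gradient (fun x : EuclideanSpace ℝ (Fin N) => ζ ‖x‖) x = (deriv ζ ‖x‖ / ‖x‖) • x := by
  refine HasGradientAt.gradient ?_
  rw [hasGradientAt_iff_hasFDerivAt]
  refine (h.hasFDerivAt_norm x).congr_fderiv ?_
  ext v
  simp

lemma memLp_norm (h : IsAnnularProfile ζ a b) :
    MemLp (fun x : EuclideanSpace ℝ (Fin N) => ζ ‖x‖) 2 (ballMeasure N R) :=
  h.contDiff_norm.continuous.memLp_of_hasCompactSupport h.hasCompactSupport_norm

lemma memLp_gradient (h : IsAnnularProfile ζ a b) :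
    MemLp (fun x : EuclideanSpace ℝ (Fin N) => (deriv ζ ‖x‖ / ‖x‖) • x) 2 (ballMeasure N R) := by
  simp_rw [← h.gradient_norm]
  refine Continuous.memLp_of_hasCompactSupport ?_ ?_
  · exact (InnerProductSpace.toDual ℝ _).symm.continuous.comp
      (h.contDiff_norm.continuous_fderiv (by simp))
  · exact (h.hasCompactSupport_norm.fderiv (𝕜 := ℝ)).comp_left
      (g := (InnerProductSpace.toDual ℝ (EuclideanSpace ℝ (Fin N))).symm) (by simp)

/-- The pair `(u, ∇u)` for the smooth radial function `u(x) = ζ(|x|)`. -/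
def pair (h : IsAnnularProfile ζ a b) (N : ℕ) (R : ℝ) : L2Pair N R :=
  (h.memLp_norm.toLp _, h.memLp_gradient.toLp _)

lemma pair_fst (h : IsAnnularProfile ζ a b) :
    ∀ᵐ x ∂(ballMeasure N R), (h.pair N R).1 x = ζ ‖x‖ := h.memLp_norm.coeFn_toLp

lemma pair_snd (h : IsAnnularProfile ζ a b) :
    ∀ᵐ x ∂(ballMeasure N R), (h.pair N R).2 x = (deriv ζ ‖x‖ / ‖x‖) • x :=
  h.memLp_gradient.coeFn_toLp

lemma pair_mem_H1rad (h : IsAnnularProfile ζ a b) (hN : 1 ≤ N) : h.pair N R ∈ H1rad N R := by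
  refine ⟨?_, ?_⟩
  · -- a measurable representative: restrict the radial function to a ray
    set e : EuclideanSpace ℝ (Fin N) := EuclideanSpace.single ⟨0, hN⟩ (1 : ℝ) with he
    refine ⟨fun r => ζ ‖r • e‖, ?_, ?_⟩
    · exact (h.contDiff_norm.continuous.comp
        (by fun_prop : Continuous fun r : ℝ => r • e)).measurable
    · filter_upwards [h.pair_fst (N := N) (R := R)] with x hx
      rw [hx, norm_smul, norm_norm, he]
      simp
  · intro ψ h1 h2 h3 v
    have hφ := h.contDiff_norm (N := N)
    have hz : ∀ x, x ∉ Metric.ball (0 : EuclideanSpace ℝ (Fin N)) R → ψ x = 0 := by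
      intro x hx
      by_contra hne
      exact hx (h3 (subset_tsupport _ hne))
    have hz' : ∀ x, x ∉ Metric.ball (0 : EuclideanSpace ℝ (Fin N)) R → fderiv ℝ ψ x = 0 := by
      intro x hx
      by_contra hne
      exact hx (h3 (tsupport_fderiv_subset ℝ (subset_tsupport _ hne)))
    have e1 : ∫ x, (h.pair N R).1 x * fderiv ℝ ψ x v ∂(ballMeasure N R) =
        ∫ x : EuclideanSpace ℝ (Fin N), ζ ‖x‖ * fderiv ℝ ψ x v := by
      rw [← setIntegral_eq_integral_of_forall_compl_eq_zero
        (s := Metric.ball (0 : EuclideanSpace ℝ (Fin N)) R)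
        (f := fun x => ζ ‖x‖ * fderiv ℝ ψ x v) fun x hx => by rw [hz' x hx]; simp]
      apply integral_congr_ae
      filter_upwards [h.pair_fst (N := N) (R := R)] with x hx
      rw [hx]
    have e2 : ∫ x, inner ℝ ((h.pair N R).2 x) v * ψ x ∂(ballMeasure N R) =
        ∫ x : EuclideanSpace ℝ (Fin N),
          fderiv ℝ (fun x : EuclideanSpace ℝ (Fin N) => ζ ‖x‖) x v * ψ x := by
      rw [← setIntegral_eq_integral_of_forall_compl_eq_zero
        (s := Metric.ball (0 : EuclideanSpace ℝ (Fin N)) R)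
        (f := fun x => fderiv ℝ (fun x : EuclideanSpace ℝ (Fin N) => ζ ‖x‖) x v * ψ x)
        fun x hx => by rw [hz x hx]; simp]
      apply integral_congr_ae
      filter_upwards [h.pair_snd (N := N) (R := R)] with x hx
      rw [hx, h.fderiv_norm_apply, real_inner_smul_left]
    rw [e1, e2]
    have hc1 : Continuous fun x => fderiv ℝ ψ x v :=
      (h1.continuous_fderiv (by simp)).clm_apply continuous_const
    have hc2 : Continuous fun x => fderiv ℝ (fun x : EuclideanSpace ℝ (Fin N) => ζ ‖x‖) x v :=
      (hφ.continuous_fderiv (by simp)).clm_apply continuous_const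
    apply integral_mul_fderiv_eq_neg_fderiv_mul_of_integrable
    · exact (hc2.mul h1.continuous).integrable_of_hasCompactSupport h2.mul_left
    · exact (hφ.continuous.mul hc1).integrable_of_hasCompactSupport
        h.hasCompactSupport_norm.mul_right
    · exact (hφ.continuous.mul h1.continuous).integrable_of_hasCompactSupport h2.mul_left
    · exact fun x _ => (hφ.differentiable (by simp)) x
    · exact fun x _ => (h1.differentiable (by simp)) x

lemma pair_mem_formDomain (h : IsAnnularProfile ζ a b) (hN : 1 ≤ N) {V : ℝ → ℝ}
    (hV : ContinuousOn V (Set.Ioi 0)) : h.pair N R ∈ formDomain N R V := by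
  have hc : ContinuousOn (fun r => √(V r) * ζ r) (Set.Ioi 0) :=
    hV.sqrt.mul h.contDiffOn.continuousOn
  obtain ⟨C, hC⟩ := isCompact_Icc.exists_bound_of_continuousOn
    (hc.mono fun r (hr : r ∈ Set.Icc a b) => h.pos.trans_le hr.1)
  have h1 : MemLp (fun x => √(V ‖x‖) * ζ ‖x‖) 2 (ballMeasure N R) := by
    refine MemLp.of_bound (aestronglyMeasurable_radial hN hc) (max C 0)
      (Eventually.of_forall fun x => ?_)
    by_cases hx : ‖x‖ ∈ Set.Icc a b
    · exact (hC _ hx).trans (le_max_left _ _)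
    · rw [h.eq_zero _ (norm_nonneg _) hx, mul_zero, norm_zero]
      exact le_max_right _ _
  refine h1.ae_eq ?_
  filter_upwards [h.pair_fst (N := N) (R := R)] with x hx
  rw [hx]

lemma linForm_pair_self (h : IsAnnularProfile ζ a b) (hN : 1 ≤ N) (hab : a ≤ b) (hb : b < R) :
    linForm p U (h.pair N R) (h.pair N R) = sphereArea N *
      ∫ r in a..b, r ^ (N - 1) * (deriv ζ r ^ 2 + ζ r ^ 2 - potential p U r * ζ r ^ 2) := by
  have h1 : linForm p U (h.pair N R) (h.pair N R) = ∫ x, (fun r => deriv ζ r ^ 2 + ζ r ^ 2 -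
      potential p U r * ζ r ^ 2) ‖x‖ ∂(ballMeasure N R) := by
    unfold linForm
    apply integral_congr_ae
    filter_upwards [h.pair_fst (N := N) (R := R), h.pair_snd (N := N) (R := R),
      ae_ball_norm_pos (R := R) hN] with x h1 h2 h3
    rw [h1, h2, real_inner_smul_left, real_inner_smul_right, real_inner_self_eq_norm_sq,
      potential]
    field_simp
  rw [h1, integral_ball_radial hN R fun r => deriv ζ r ^ 2 + ζ r ^ 2 - potential p U r * ζ r ^ 2]
  congr 1
  rw [intervalIntegral.integral_of_le hab, ← integral_Icc_eq_integral_Ioc]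
  have hsub : Set.Icc a b ⊆ Set.Ioo 0 R := fun r hr => ⟨h.pos.trans_le hr.1, hr.2.trans_lt hb⟩
  refine (setIntegral_eq_of_subset_of_forall_sdiff_eq_zero measurableSet_Ioo hsub ?_)
  intro r hr
  rw [h.eq_zero r hr.1.1.le hr.2, h.deriv_eq_zero hr.1.1 hr.2]
  simp

lemma linForm_pair_of_disjoint {ζ' : ℝ → ℝ} {a' b' : ℝ} (h : IsAnnularProfile ζ a b)
    (h' : IsAnnularProfile ζ' a' b') (hN : 1 ≤ N) (hd : Disjoint (Set.Icc a b) (Set.Icc a' b')) :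
    linForm p U (h.pair N R) (h'.pair N R) = 0 := by
  unfold linForm
  apply integral_eq_zero_of_ae
  filter_upwards [h.pair_fst (N := N) (R := R), h.pair_snd (N := N) (R := R),
    h'.pair_fst (N := N) (R := R), h'.pair_snd (N := N) (R := R),
    ae_ball_norm_pos (R := R) hN] with x h1 h2 h3 h4 h5
  rw [h1, h2, h3, h4]
  by_cases hx : ‖x‖ ∈ Set.Icc a b
  · have hx' := Set.disjoint_left.1 hd hx
    simp [h'.eq_zero _ h5.le hx', h'.deriv_eq_zero h5 hx']
  · simp [h.eq_zero _ h5.le hx, h.deriv_eq_zero h5 hx]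

end IsAnnularProfile

/-- Infinitely many mutually orthogonal directions of negative energy make the Morse index
infinite. -/
lemma radialMorseIndex_eq_top (hN : 1 ≤ N) (hV : ∀ r, 0 < r → 0 ≤ potential p U r)
    {w : ℕ → L2Pair N R} (hw : ∀ i, w i ∈ H1rad N R)
    (hwD : ∀ i, w i ∈ formDomain N R (potential p U))
    (horth : ∀ i j, i ≠ j → linForm p U (w i) (w j) = 0)
    (hneg : ∀ i, linForm p U (w i) (w i) < 0) : radialMorseIndex N R p U = ⊤ := by
  rw [ENat.eq_top_iff_forall_ge]
  intro n
  set A : (Fin n → ℝ) →ₗ[ℝ] L2Pair N R := Fintype.linearCombination ℝ fun i : Fin n => w i with hA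
  have hA' : ∀ t, A t = ∑ i, t i • w i := fun t => Fintype.linearCombination_apply ..
  have hform : ∀ t, linForm p U (A t) (A t) = ∑ i, t i ^ 2 * linForm p U (w i) (w i) := by
    intro t
    rw [hA', linForm_sum_sum hN hV _ (w := fun i : Fin n => t i • w i)
      fun i => Submodule.smul_mem _ _ (hwD i)]
    refine Finset.sum_congr rfl fun i _ => ?_
    have hij : ∀ j : Fin n, linForm p U (t i • w i) (t j • w j) =
        t i * (t j * linForm p U (w i) (w j)) := fun j => by
      rw [linForm_smul_left, linForm_comm, linForm_smul_left, linForm_comm]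
    rw [Finset.sum_eq_single i, hij]
    · ring
    · intro j _ hne
      rw [hij, horth i j fun h => hne (Fin.ext h.symm)]
      ring
    · simp
  have hlt : ∀ t, t ≠ 0 → linForm p U (A t) (A t) < 0 := by
    intro t ht
    obtain ⟨i, hi⟩ := Function.ne_iff.1 ht
    rw [hform]
    refine Finset.sum_neg' (fun j _ => mul_nonpos_of_nonneg_of_nonpos (sq_nonneg _) (hneg j).le)
      ⟨i, Finset.mem_univ i, mul_neg_of_pos_of_neg ?_ (hneg i)⟩
    have : t i ≠ 0 := hi
    positivity
  have hinj : Function.Injective A := by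
    rw [← LinearMap.ker_eq_bot, LinearMap.ker_eq_bot']
    intro t ht
    by_contra hne
    have h1 := hlt t hne
    have h2 := hform 0
    rw [map_zero] at h2
    rw [ht, h2] at h1
    simp at h1
  have hfin : Module.finrank ℝ (LinearMap.range A) = n := by
    rw [LinearMap.finrank_range_of_inj hinj, Module.finrank_fin_fun]
  unfold radialMorseIndex
  refine le_iSup₂_of_le (LinearMap.range A) ⟨?_, inferInstance, ?_⟩ (by rw [hfin])
  · rintro _ ⟨t, rfl⟩
    rw [hA']
    exact Submodule.sum_mem _ fun i _ => Submodule.smul_mem _ _ (hw i)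
  · rintro _ ⟨t, rfl⟩ hne
    exact hlt t fun h => hne (by rw [h, map_zero])

end RadialPair

/-! ### Infinite Morse index below the Joseph-Lundgren exponent -/

/-- The profile `r^{-κ} β(m log r + d)`: a bump `β`, stretched and translated in the variable
`log r`, times the borderline power of Hardy's inequality. -/
def logBump (β : ℝ → ℝ) (κ m d r : ℝ) : ℝ := r ^ (-κ) * β (m * Real.log r + d)

section LogBump

variable {β : ℝ → ℝ} {κ m d : ℝ}

lemma hasDerivAt_logBump (hβ : ContDiff ℝ ∞ β) {r : ℝ} (hr : 0 < r) :
    HasDerivAt (logBump β κ m d)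
      (r ^ (-κ - 1) * (m * deriv β (m * Real.log r + d) - κ * β (m * Real.log r + d))) r := by
  have h1 : HasDerivAt (fun r : ℝ => r ^ (-κ)) (-κ * r ^ (-κ - 1)) r :=
    Real.hasDerivAt_rpow_const (Or.inl hr.ne')
  have h2 : HasDerivAt (fun r : ℝ => m * Real.log r + d) (m * r⁻¹) r :=
    ((Real.hasDerivAt_log hr.ne').const_mul m).add_const d
  have h3 := (((hβ.differentiable (by simp)) (m * Real.log r + d)).hasDerivAt).comp r h2
  refine (h1.mul h3).congr_deriv ?_
  have h4 : r ^ (-κ) = r ^ (-κ - 1) * r := by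
    rw [Real.rpow_sub_one hr.ne']
    field_simp
  simp only [Function.comp_apply]
  rw [h4]
  field_simp
  ring

lemma isAnnularProfile_logBump (hβ : ContDiff ℝ ∞ β) (hβ0 : ∀ x, 1 ≤ |x| → β x = 0)
    (hm : 0 < m) (hd : 1 ≤ d) :
    IsAnnularProfile (logBump β κ m d) (Real.exp ((-1 - d) / m)) (Real.exp ((1 - d) / m)) := by
  refine ⟨?_, ?_, Real.exp_pos _⟩
  · have h1 : ContDiffOn ℝ ∞ (fun r : ℝ => r ^ (-κ)) (Set.Ioi 0) :=
      contDiffOn_id.rpow_const_of_ne fun r hr => ne_of_gt hr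
    have h2 : ContDiffOn ℝ ∞ (fun r : ℝ => m * Real.log r + d) (Set.Ioi 0) :=
      (contDiffOn_const.mul (contDiffOn_id.log fun r hr => ne_of_gt hr)).add contDiffOn_const
    exact h1.mul (hβ.comp_contDiffOn h2)
  · intro r hr hr'
    rw [logBump, hβ0, mul_zero]
    rcases hr.eq_or_lt with rfl | hr0
    · rw [Real.log_zero, mul_zero, zero_add, abs_of_nonneg (by linarith)]
      exact hd
    · by_contra! hlt
      rw [abs_lt] at hlt
      apply hr'
      rw [← Real.exp_log hr0, Set.mem_Icc, Real.exp_le_exp, Real.exp_le_exp, div_le_iff₀ hm,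
        le_div_iff₀ hm]
      constructor <;> linarith

/-- In the variable `s = m log r + d` the Hardy quotient of `logBump` becomes a one dimensional
quotient with constant coefficients. -/
lemma integral_logBump (hβ : ContDiff ℝ ∞ β) (hβ0 : ∀ x, 1 ≤ |x| → β x = 0) {N : ℕ} (hN : 3 ≤ N)
    (hm : 0 < m) (c : ℝ) :
    ∫ r in (Real.exp ((-1 - d) / m))..(Real.exp ((1 - d) / m)),
      r ^ (N - 1) * (deriv (logBump β (((N : ℝ) - 2) / 2) m d) r ^ 2 -
        c / r ^ 2 * logBump β (((N : ℝ) - 2) / 2) m d r ^ 2) =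
      m * (∫ s in (-1)..1, deriv β s ^ 2) +
        m⁻¹ * (((((N : ℝ) - 2) / 2) ^ 2 - c) * ∫ s in (-1)..1, β s ^ 2) := by
  set κ : ℝ := ((N : ℝ) - 2) / 2 with hκ
  have hβd : Continuous (deriv β) := hβ.continuous_deriv (by simp)
  have hβc := hβ.continuous
  set H : ℝ → ℝ := fun s => m⁻¹ * ((m * deriv β s - κ * β s) ^ 2 - c * β s ^ 2) with hH
  have hHc : Continuous H := by fun_prop
  have hle : Real.exp ((-1 - d) / m) ≤ Real.exp ((1 - d) / m) := by
    rw [Real.exp_le_exp, div_le_div_iff_of_pos_right hm]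
    linarith
  have hpos : ∀ r ∈ Set.uIcc (Real.exp ((-1 - d) / m)) (Real.exp ((1 - d) / m)), 0 < r := by
    intro r hr
    rw [Set.uIcc_of_le hle] at hr
    exact (Real.exp_pos _).trans_le hr.1
  have hend : ∀ t, m * Real.log (Real.exp ((t - d) / m)) + d = t := fun t => by
    rw [Real.log_exp]
    field_simp
    ring
  have h1 := intervalIntegral.integral_comp_mul_deriv (g := H)
    (f := fun r => m * Real.log r + d) (f' := fun r => m * r⁻¹)
    (a := Real.exp ((-1 - d) / m)) (b := Real.exp ((1 - d) / m))
    (fun r hr => ((Real.hasDerivAt_log (hpos r hr).ne').const_mul m).add_const d)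
    (continuousOn_const.mul (continuousOn_id.inv₀ fun r hr => (hpos r hr).ne')) hHc
  rw [hend, hend] at h1
  have h2 : ∫ r in (Real.exp ((-1 - d) / m))..(Real.exp ((1 - d) / m)),
      r ^ (N - 1) * (deriv (logBump β κ m d) r ^ 2 - c / r ^ 2 * logBump β κ m d r ^ 2) =
      ∫ s in (-1)..1, H s := by
    rw [← h1]
    refine intervalIntegral.integral_congr fun r hr => ?_
    have hr0 := hpos r hr
    have hκ2 : r ^ (N - 1) * (r ^ (-κ - 1)) ^ 2 = r⁻¹ := by
      rw [← Real.rpow_natCast r (N - 1), ← Real.rpow_mul_natCast hr0.le, ← Real.rpow_add hr0,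
        ← Real.rpow_neg_one]
      congr 1
      rw [Nat.cast_sub (by omega)]
      simp only [hκ]
      push_cast
      ring
    have hκ3 : r ^ (-κ) = r ^ (-κ - 1) * r := by
      rw [Real.rpow_sub_one hr0.ne']
      field_simp
    simp only [(hasDerivAt_logBump hβ hr0).deriv, logBump, Function.comp_apply, hH]
    rw [hκ3]
    set σ := m * Real.log r + d
    have e1 : r ^ (N - 1) * ((r ^ (-κ - 1) * (m * deriv β σ - κ * β σ)) ^ 2 -
        c / r ^ 2 * (r ^ (-κ - 1) * r * β σ) ^ 2) =
        r ^ (N - 1) * (r ^ (-κ - 1)) ^ 2 * ((m * deriv β σ - κ * β σ) ^ 2 - c * β σ ^ 2) := by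
      field_simp
    rw [e1, hκ2]
    field_simp
  rw [h2]
  have h3 : ∫ s in (-1)..1, 2 * β s * deriv β s = 0 := by
    have hder : ∀ s ∈ Set.uIcc (-1 : ℝ) 1, HasDerivAt (fun s => β s ^ 2) (2 * β s * deriv β s) s :=
      fun s _ => by
        have := ((hβ.differentiable (by simp)) s).hasDerivAt.fun_pow 2
        simpa using this
    rw [intervalIntegral.integral_eq_sub_of_hasDerivAt hder
      (Continuous.intervalIntegrable (by fun_prop) _ _), hβ0 1 (by simp), hβ0 (-1) (by simp)]
    simp
  have h4 : ∀ s, H s = (m * deriv β s ^ 2 - κ * (2 * β s * deriv β s)) +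
      m⁻¹ * ((κ ^ 2 - c) * β s ^ 2) := fun s => by
    simp only [hH]
    field_simp
    ring
  simp_rw [h4]
  rw [intervalIntegral.integral_add (Continuous.intervalIntegrable (by fun_prop) _ _)
      (Continuous.intervalIntegrable (by fun_prop) _ _),
    intervalIntegral.integral_sub (Continuous.intervalIntegrable (by fun_prop) _ _)
      (Continuous.intervalIntegrable (by fun_prop) _ _)]
  simp only [intervalIntegral.integral_const_mul]
  rw [h3, mul_zero, sub_zero]

end LogBump

/-- Above Hardy's constant, wide bumps in the variable `log r` have negative energy; translates
with disjoint supports near the origin give infinitely many independent directions. -/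
theorem radialMorseIndex_eq_top_of_lt_pJL {N : ℕ} (hN : 3 ≤ N) {R : ℝ} (hR : 0 < R) {p : ℝ}
    (hp : pCrit N < p) {U : ℝ → ℝ} (hU : IsSingularSolution N p U) (h : (p : EReal) < pJL N) :
    radialMorseIndex N R p U = ⊤ := by
  set κ : ℝ := ((N : ℝ) - 2) / 2 with hκ
  obtain ⟨c, hc, hc'⟩ := exists_between (lt_hardyStrength_of_lt_pJL hN hp h)
  have hV0 : ∀ r, 0 < r → 0 ≤ potential p U r := fun r hr =>
    hU.potential_nonneg (one_lt_of_pCrit_lt hN hp) hr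
  have hVc := hU.continuousOn_potential
  -- near the origin the potential absorbs the zero order term as well
  obtain ⟨δ, hδ, hδR, hδV⟩ : ∃ δ, 0 < δ ∧ δ < R ∧
      ∀ r, 0 < r → r ≤ δ → c / r ^ 2 + 1 ≤ potential p U r := by
    have h1 : Tendsto (fun r => r ^ 2 * potential p U r - r ^ 2) (𝓝[>] 0)
        (𝓝 (hardyStrength N p - 0 ^ 2)) := by
      refine (IsSingularSolution.tendsto_sq_mul_potential hN hp hU).sub ?_
      exact ((continuous_pow 2).tendsto 0).mono_left nhdsWithin_le_nhds
    have h2 := h1.eventually (Ici_mem_nhds (show c < hardyStrength N p - 0 ^ 2 by simpa using hc'))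
    obtain ⟨b, hb, hb'⟩ := mem_nhdsGT_iff_exists_Ioc_subset.1 h2
    have hb0 : (0 : ℝ) < b := hb
    refine ⟨min b (R / 2), by positivity, (min_le_right _ _).trans_lt (by linarith), ?_⟩
    intro r hr hrδ
    have h3 : c ≤ r ^ 2 * potential p U r - r ^ 2 := hb' ⟨hr, hrδ.trans (min_le_left _ _)⟩
    rw [← sub_nonneg]
    have h4 : potential p U r - (c / r ^ 2 + 1) =
        (r ^ 2 * potential p U r - r ^ 2 - c) / r ^ 2 := by field_simp; ring
    rw [h4]
    exact div_nonneg (by linarith) (by positivity)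
  obtain ⟨β, hβ, hβ0, hβpos⟩ : ∃ β : ℝ → ℝ, ContDiff ℝ ∞ β ∧ (∀ x, 1 ≤ |x| → β x = 0) ∧
      0 < ∫ s in (-1)..1, β s ^ 2 := by
    let B : ContDiffBump (0 : ℝ) := ⟨1 / 2, 1, by norm_num, by norm_num⟩
    have hsupp : Function.support B = Metric.ball 0 1 := B.support_eq
    refine ⟨B, B.contDiff, fun x hx => ?_, ?_⟩
    · by_contra hne
      have : x ∈ Metric.ball (0 : ℝ) 1 := by rw [← hsupp]; exact hne
      rw [Metric.mem_ball, dist_zero_right, Real.norm_eq_abs] at this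
      linarith
    · refine intervalIntegral.intervalIntegral_pos_of_pos_on
        (Continuous.intervalIntegrable (B.continuous.pow 2) _ _) (fun x hx => ?_) (by norm_num)
      have : x ∈ Function.support B := by
        rw [hsupp, Real.ball_eq_Ioo]
        simpa using hx
      have hne : B x ≠ 0 := this
      positivity
  rw [← hκ] at hc
  set A := ∫ s in (-1)..1, deriv β s ^ 2 with hA
  set D := ∫ s in (-1)..1, β s ^ 2 with hD
  have hA0 : 0 ≤ A := intervalIntegral.integral_nonneg (by norm_num) fun s _ => sq_nonneg _
  have hcD : 0 < (c - κ ^ 2) * D := mul_pos (by linarith) hβpos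
  obtain ⟨m, hm, hmneg⟩ : ∃ m : ℝ, 0 < m ∧ m * A + m⁻¹ * ((κ ^ 2 - c) * D) < 0 := by
    have h1 : Tendsto (fun m : ℝ => m ^ 2 * A) (𝓝[>] 0) (𝓝 (0 ^ 2 * A)) :=
      (Continuous.tendsto (by fun_prop) 0).mono_left nhdsWithin_le_nhds
    have h2 := h1.eventually (Iio_mem_nhds (show (0 : ℝ) ^ 2 * A < (c - κ ^ 2) * D by
      simpa using hcD))
    obtain ⟨m, hm1, hm2⟩ := (h2.and self_mem_nhdsWithin).exists
    have hm0 : (0 : ℝ) < m := hm2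
    refine ⟨m, hm0, ?_⟩
    have h3 : m * A + m⁻¹ * ((κ ^ 2 - c) * D) = m⁻¹ * (m ^ 2 * A - (c - κ ^ 2) * D) := by
      field_simp
      ring
    rw [h3]
    have h4 : m ^ 2 * A < (c - κ ^ 2) * D := hm1
    exact mul_neg_of_pos_of_neg (inv_pos.2 hm0) (by linarith)
  set d : ℕ → ℝ := fun j => max 1 (1 - m * Real.log δ) + 3 * j with hd
  have hd1 : ∀ j, 1 ≤ d j := fun j => by
    have := le_max_left 1 (1 - m * Real.log δ)
    have : (0 : ℝ) ≤ j := Nat.cast_nonneg j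
    simp only [hd]
    linarith
  have hprof := fun j => isAnnularProfile_logBump (κ := κ) hβ hβ0 hm (hd1 j)
  have hbδ : ∀ j, Real.exp ((1 - d j) / m) ≤ δ := fun j => by
    rw [← Real.le_log_iff_exp_le hδ, div_le_iff₀ hm]
    have := le_max_right 1 (1 - m * Real.log δ)
    have : (0 : ℝ) ≤ j := Nat.cast_nonneg j
    simp only [hd]
    linarith
  have hle : ∀ j, Real.exp ((-1 - d j) / m) ≤ Real.exp ((1 - d j) / m) := fun j => by
    rw [Real.exp_le_exp, div_le_div_iff_of_pos_right hm]
    linarith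
  refine radialMorseIndex_eq_top (by omega) hV0 (w := fun j => (hprof j).pair N R)
    (fun j => (hprof j).pair_mem_H1rad (by omega))
    (fun j => (hprof j).pair_mem_formDomain (by omega) hVc) ?_ ?_
  · have hlt : ∀ i j : ℕ, i < j →
        Real.exp ((1 - d j) / m) < Real.exp ((-1 - d i) / m) := fun i j hij => by
      rw [Real.exp_lt_exp, div_lt_div_iff_of_pos_right hm]
      have : ((i + 1 : ℕ) : ℝ) ≤ j := by exact_mod_cast hij
      push_cast at this
      simp only [hd]
      linarith
    intro i j hij
    refine (hprof i).linForm_pair_of_disjoint (hprof j) (by omega) ?_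
    rw [Set.disjoint_left]
    intro r hr hr'
    rcases lt_or_gt_of_ne hij with h1 | h1
    · linarith [hlt i j h1, hr.1, hr'.2]
    · linarith [hlt j i h1, hr'.1, hr.2]
  · intro j
    rw [(hprof j).linForm_pair_self (by omega) (hle j) ((hbδ j).trans_lt hδR)]
    refine mul_neg_of_pos_of_neg (sphereArea_pos (by omega)) (lt_of_le_of_lt ?_ hmneg)
    rw [← integral_logBump (d := d j) hβ hβ0 hN hm c, ← hκ]
    have hpos : ∀ r ∈ Set.uIcc (Real.exp ((-1 - d j) / m)) (Real.exp ((1 - d j) / m)), 0 < r := by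
      intro r hr
      rw [Set.uIcc_of_le (hle j)] at hr
      exact (Real.exp_pos _).trans_le hr.1
    have hc1 : ContinuousOn (logBump β κ m (d j))
        (Set.uIcc (Real.exp ((-1 - d j) / m)) (Real.exp ((1 - d j) / m))) :=
      (hprof j).contDiffOn.continuousOn.mono hpos
    have hc2 : ContinuousOn (deriv (logBump β κ m (d j)))
        (Set.uIcc (Real.exp ((-1 - d j) / m)) (Real.exp ((1 - d j) / m))) :=
      ((hprof j).contDiffOn.continuousOn_deriv_of_isOpen isOpen_Ioi (by simp)).mono hpos
    have hc3 := hVc.mono hpos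
    refine intervalIntegral.integral_mono_on (hle j)
      (ContinuousOn.intervalIntegrable (by fun_prop))
      (ContinuousOn.intervalIntegrable ?_) fun r hr => ?_
    · have hc4 : ContinuousOn (fun r : ℝ => c / r ^ 2)
          (Set.uIcc (Real.exp ((-1 - d j) / m)) (Real.exp ((1 - d j) / m))) :=
        continuousOn_const.div (by fun_prop) fun r hr => pow_ne_zero _ (hpos r hr).ne'
      fun_prop
    · have hr0 : 0 < r := (Real.exp_pos _).trans_le hr.1
      have h1 := hδV r hr0 (hr.2.trans (hbδ j))
      refine mul_le_mul_of_nonneg_left ?_ (by positivity)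
      have h2 := mul_le_mul_of_nonneg_right h1 (sq_nonneg (logBump β κ m (d j) r))
      linarith

end LinNiTakagi

end

theorem proposition1p6 (N : ℕ) (hN : 3 ≤ N) (R : ℝ) (hR : 0 < R)
    (p : ℝ) (hp : LinNiTakagi.pCrit N < p)
    (U : ℝ → ℝ) (hU : LinNiTakagi.IsSingularSolution N p U) (hUR : deriv U R = 0) :
    (LinNiTakagi.pJL N < (p : EReal) →
      LinNiTakagi.radialMorseIndex N R p U < ⊤ ∧
        FiniteDimensional ℝ (LinNiTakagi.negativeEigenspace N R p U)) ∧
    ((p : EReal) < LinNiTakagi.pJL N → LinNiTakagi.radialMorseIndex N R p U = ⊤) := by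
  exact ⟨fun h => LinNiTakagi.finite_of_pJL_lt hN hR hp hU h,
    fun h => LinNiTakagi.radialMorseIndex_eq_top_of_lt_pJL hN hR hp hU h⟩
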